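/- Let $d\in\{2,3\}$ and let $\Omega\subset\mathbb R^d$ be a bounded polygonal ($d=2$) or polyhedral ($d=3$) domain, equal to the interior of its closure. Let $\alpha\in W^{1,\infty}(\Omega)$ with $\alpha\ge\alpha_0>0$ a.e., let $\beta\in L^\infty(\Omega)$ with $\beta\ge\beta_0>0$ a.e., and let $\delta>1$. Put $a(u,v)=\int_\Omega(\alpha\nabla u\cdot\nabla v+\beta uv)\,dx$, $b(u,v)=\int_{\partial\Omega}uv\,ds$. An eigenpair of the Steklov problem is a pair $(\lambda,u)\in\mathbb R\times H^1(\Omega)$ with $b(u,u)=1$ and $a(u,v)=\lambda b(u,v)$ for all $v\in H^1(\Omega)$. For a conforming simplicial mesh $\pi_h$ of $\Omega$ with elements $\kappa$ of diameter $h_\kappa$ and mesh size $h=\max_\kappa h_\kappa$, let $V_h$ be the Crouzeix–Raviart space of functions that are affine on each $\kappa$ and continuous at the barycenters of the $(d-1)$-dimensional faces. Put $a_h(u,v)=\sum_\kappa\int_\kappa(\alpha\nabla u\cdot\nabla v+\beta uv)\,dx$. A discrete eigenpair is $(\lambda_h,u_h)\in\mathbb R\times V_h$ with $b(u_h,u_h)=1$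 and $a_h(u_h,v)=\lambda_h b(u_h,v)$ for all $v\in V_h$. In both problems, eigenvalues are numbered in increasing order, counted with multiplicity. Let $I_0\alpha$ be piecewise constant, its value on each $\kappa$ lying between the essential infimum and the essential supremum of $\alpha$ on $\kappa$ (for example the mean value, or the value of the continuous representative at a point of $\kappa$). Let $C_{h_\kappa}=0.1893\,h_\kappa$ if $d=2$ and $C_{h_\kappa}=0.3804\,h_\kappa$ if $d=3$, and let $$M=\frac{\delta}{\alpha_0}\sum_{\kappa\in\pi_h}\bigl(\|(\alpha-I_0\alpha)\nabla u_h\|_{L^2(\kappa)}+C_{h_\kappa}\|\beta u_h\|_{L^2(\kappa)}\bigr)^2,$$ $$\lambda_h^c=\frac{\lambda_h}{1+\frac{\delta}{\lambda_h\alpha_0}\sum_{\kappa\in\pi_h}\bigl(\|(\alpha-I_0\alpha)\nabla u_h\|_{L^2(\kappa)}+C_{h_\kappa}\|\beta u_h\|_{L^2(\kappa)}\bigr)^2}.$$ **Theorem 3.2.** 1. There is a constant $C>0$, depending only on $\Omega,\alpha,\beta,\alpha_0,\beta_0,\delta$, such that for every mesh, every $I_0\alpha$ as above, every eigenpair $(\lambda,u)$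 and every discrete eigenpair $(\lambda_h,u_h)$, $$\lambda-\lambda_h^c=(\lambda-\lambda_h)+\frac{\lambda_hM}{\lambda_h+M},\qquad |M|\le C\,\lambda_h\,h^2 .$$ 2. For every $\sigma>0$ and $j\ge1$ there are $C>0$ and $h_0>0$, depending only on $\sigma$, $j$ and the data in 1, such that $|M|\le C h^2$ for every mesh with $h\le h_0$ in which each element $\kappa$ contains a closed ball of radius $h_\kappa/\sigma$ (a regular mesh), every $I_0\alpha$ as above, and every $j$-th discrete eigenpair $(\lambda_h,u_h)$. 3. $\lambda_h^c$ has the same convergence order as $\lambda_h$: let $\lambda$ be the $j$-th eigenvalue, and consider a sequence of meshes that are regular with a common $\sigma$ and have $h\to0$, with $I_0\alpha$ as above and $j$-th discrete eigenpairs $(\lambda_h,u_h)$. Then for $0<s\le2$, $$\lambda-\lambda_h=O(h^s)\iff\lambda-\lambda_h^c=O(h^s),$$ and for $0<s<2$, $\lambda-\lambda_h=\Theta(h^s)\iff\lambda-\lambda_h^c=\Theta(h^s)$. -/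

import Mathlib

open MeasureTheory Filter Topology Asymptotics
open scoped ENNReal ContDiff

noncomputable section

namespace Steklov

/-- The Euclidean space `ℝ^d`. -/
abbrev E (d : ℕ) : Type := EuclideanSpace ℝ (Fin d)

variable {d : ℕ}

/-- A bounded polygonal (`d = 2`) or polyhedral (`d = 3`) domain: a bounded connected open set whose
closure is a finite union of convex polytopes, lying locally on one side of its boundary
(no cracks). -/
structure IsPolyhedralDomain (Ω : Set (E d)) : Prop where
  isOpen : IsOpen Ω
  isConnected : IsConnected Ω
  isBounded : Bornology.IsBounded Ω
  interior_closure : interior (closure Ω) = Ω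
  polyhedral : ∃ P : Finset (Finset (E d)), closure Ω = ⋃ s ∈ P, convexHull ℝ (s : Set (E d))

/-- The surface measure `ds` on the boundary of `Ω`: the `(d-1)`-dimensional Hausdorff measure,
normalized so as to agree with Lebesgue measure on hyperplanes. -/
def surfaceMeasure (Ω : Set (E d)) : Measure (E d) :=
  (Measure.euclideanHausdorffMeasure (d - 1)).restrict (frontier Ω)

/-- `g` is a weak gradient of `u` on the open set `Ω`: integration by parts holds against all test
functions in `C_c^∞(Ω)`. -/
def IsWeakGradient (Ω : Set (E d)) (u : E d → ℝ) (g : E d → E d) : Prop :=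
  ∀ φ : E d → ℝ, ContDiff ℝ ∞ φ → HasCompactSupport φ → tsupport φ ⊆ Ω →
    ∫ x in Ω, u x • gradient φ x = - ∫ x in Ω, φ x • g x

/-- `u ∈ W^{1,∞}(Ω)`. -/
def MemW1Inf (Ω : Set (E d)) (u : E d → ℝ) : Prop :=
  MemLp u ∞ (volume.restrict Ω) ∧
    ∃ g : E d → E d, MemLp g ∞ (volume.restrict Ω) ∧ IsWeakGradient Ω u g

/-- `t` is the trace on `∂Ω` of the function `u` with gradient `g`: the trace operator is the
extension by continuity of the restriction `φ ↦ φ|_{∂Ω}` of functions smooth up to the boundary,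
from the norm of `H¹(Ω)` to that of `L²(∂Ω)`. -/
def IsTrace (Ω : Set (E d)) (u : E d → ℝ) (g : E d → E d) (t : E d → ℝ) : Prop :=
  ∃ φ : ℕ → E d → ℝ, (∀ n, ContDiff ℝ ∞ (φ n)) ∧
    Tendsto (fun n => eLpNorm (fun x => φ n x - u x) 2 (volume.restrict Ω)) atTop (𝓝 0) ∧
    Tendsto (fun n => eLpNorm (fun x => gradient (φ n) x - g x) 2 (volume.restrict Ω))
      atTop (𝓝 0) ∧
    Tendsto (fun n => eLpNorm (fun x => φ n x - t x) 2 (surfaceMeasure Ω)) atTop (𝓝 0)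

/-- An element of `H¹(Ω)`, given together with (representatives of) its weak gradient and its
trace on `∂Ω`. -/
structure H1 (Ω : Set (E d)) where
  toFun : E d → ℝ
  grad : E d → E d
  trace : E d → ℝ
  memLp_toFun : MemLp toFun 2 (volume.restrict Ω)
  memLp_grad : MemLp grad 2 (volume.restrict Ω)
  memLp_trace : MemLp trace 2 (surfaceMeasure Ω)
  isWeakGradient : IsWeakGradient Ω toFun grad
  isTrace : IsTrace Ω toFun grad trace

/-- `a(u,v) = ∫_Ω (α ∇u·∇v + β u v) dx`. -/
def aForm (Ω : Set (E d)) (α β : E d → ℝ) (u v : H1 Ω) : ℝ :=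
  ∫ x in Ω, (α x * inner ℝ (u.grad x) (v.grad x) + β x * u.toFun x * v.toFun x)

/-- `b(u,v) = ∫_{∂Ω} u v ds`. -/
def bForm (Ω : Set (E d)) (u v : H1 Ω) : ℝ :=
  ∫ x, u.trace x * v.trace x ∂(surfaceMeasure Ω)

/-- A (conforming, simplicial) partition of `Ω`: a finite simplicial complex, every simplex of
which is a face of a `d`-simplex, triangulating the closure of `Ω`. -/
structure Mesh (Ω : Set (E d)) where
  complex : Geometry.SimplicialComplex ℝ (E d)
  finite : complex.faces.Finite
  pure : ∀ s ∈ complex.faces, ∃ t ∈ complex.faces, s ⊆ t ∧ t.card = d + 1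
  space_eq : complex.space = closure Ω

namespace Mesh

variable {Ω : Set (E d)} (T : Mesh Ω)

/-- The elements `κ` of the mesh, each given by its `d + 1` vertices. -/
def cells : Finset (Finset (E d)) := T.finite.toFinset.filter (fun s => s.card = d + 1)

/-- The element `κ` as a closed subset of `ℝ^d`. -/
def body (κ : T.cells) : Set (E d) := convexHull ℝ ((κ : Finset (E d)) : Set (E d))

/-- The diameter `h_κ` of an element. -/
def cellDiam (κ : T.cells) : ℝ := Metric.diam (T.body κ)

/-- The mesh diameter `h = max_κ h_κ`. -/
def meshSize : ℝ := ⨆ κ : T.cells, T.cellDiam κ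

/-- Regularity of the partition with parameter `σ`: every element `κ` contains a ball of radius
`h_κ / σ`. -/
def ShapeRegular (σ : ℝ) : Prop :=
  ∀ κ : T.cells, ∃ x, Metric.closedBall x (T.cellDiam κ / σ) ⊆ T.body κ

/-- The Crouzeix–Raviart space `V_h`. An element `v` is given by its restrictions `v κ ∈ P_1(κ)`,
and the restrictions to two elements agree at the barycenter of every common
`(d-1)`-dimensional face `e`. -/
def crSpace : Submodule ℝ (T.cells → (E d →ᵃ[ℝ] ℝ)) where
  carrier := {v | ∀ κ κ' : T.cells, ∀ e : Finset (E d), e ⊆ (κ : Finset (E d)) →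
    e ⊆ (κ' : Finset (E d)) → e.card = d →
      v κ (e.centroid ℝ id) = v κ' (e.centroid ℝ id)}
  add_mem' := by
    intro v w hv hw κ κ' e h1 h2 h3
    simp only [Pi.add_apply, AffineMap.coe_add, hv κ κ' e h1 h2 h3, hw κ κ' e h1 h2 h3]
  zero_mem' := by
    intro κ κ' e _ _ _
    simp
  smul_mem' := by
    intro c v hv κ κ' e h1 h2 h3
    simp only [Pi.smul_apply, AffineMap.coe_smul, hv κ κ' e h1 h2 h3]

/-- `a_h(u,v) = ∑_κ ∫_κ (α ∇u·∇v + β u v) dx`. -/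
def aForm (α β : E d → ℝ) (u v : T.crSpace) : ℝ :=
  ∑ κ : T.cells, ∫ x in T.body κ,
    (α x * inner ℝ (gradient (u.1 κ) x) (gradient (v.1 κ) x) + β x * u.1 κ x * v.1 κ x)

/-- `b(u,v) = ∫_{∂Ω} u v ds` on `V_h`, where `∂Ω` is split into the parts `κ ∩ ∂Ω` (which overlap
in null sets only), and the trace on `κ ∩ ∂Ω` is that of `u|_κ`. -/
def bForm (u v : T.crSpace) : ℝ :=
  ∑ κ : T.cells, ∫ x in T.body κ, u.1 κ x * v.1 κ x ∂(surfaceMeasure Ω)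

/-- The numbers `c κ` are the values of a piecewise constant interpolant `I_0 α` of `α`: on each
element the value lies between the essential infimum and the essential supremum of `α` there.
This covers the mean value over `κ` and the value (of the continuous representative) at any
point of `κ`. -/
def IsPiecewiseConstInterp (α : E d → ℝ) (c : T.cells → ℝ) : Prop :=
  ∀ κ : T.cells, essInf α (volume.restrict (T.body κ)) ≤ c κ ∧
    c κ ≤ essSup α (volume.restrict (T.body κ))

/-- The constant `C_{h_κ}`: `0.1893 h_κ` for triangles, `0.3804 h_κ` for tetrahedra. -/
def interpConst (κ : T.cells) : ℝ :=
  (if d = 2 then 0.1893 else 0.3804) * T.cellDiam κ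

/-- `‖f‖_{0,κ}`. -/
def normL2 {F : Type*} [NormedAddCommGroup F] (κ : T.cells) (f : E d → F) : ℝ :=
  Real.sqrt (∫ x in T.body κ, ‖f x‖ ^ 2)

/-- `∑_κ (‖(α - I_0 α) ∇u_h‖_{0,κ} + C_{h_κ} ‖β u_h‖_{0,κ})²`, where `I_0 α = c κ` on `κ`. -/
def correctionSum (α β : E d → ℝ) (c : T.cells → ℝ) (u : T.crSpace) : ℝ :=
  ∑ κ : T.cells, (T.normL2 κ (fun x => (α x - c κ) • gradient (u.1 κ) x) +
    T.interpConst κ * T.normL2 κ (fun x => β x * u.1 κ x)) ^ 2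

/-- `M = (δ / α₀) ∑_κ (‖(α - I_0 α) ∇u_h‖_{0,κ} + C_{h_κ} ‖β u_h‖_{0,κ})²`. -/
def corrM (α β : E d → ℝ) (α₀ δ : ℝ) (c : T.cells → ℝ) (u : T.crSpace) : ℝ :=
  δ / α₀ * T.correctionSum α β c u

/-- The corrected eigenvalue
`λ_h^c = λ_h / (1 + δ / (λ_h α₀) ∑_κ (‖(α - I_0 α) ∇u_h‖_{0,κ} + C_{h_κ} ‖β u_h‖_{0,κ})²)`. -/
def correctedEigenvalue (α β : E d → ℝ) (α₀ δ : ℝ) (c : T.cells → ℝ) (lamh : ℝ)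
    (u : T.crSpace) : ℝ :=
  lamh / (1 + δ / (lamh * α₀) * T.correctionSum α β c u)

end Mesh

/-- `(lam, u)` is a normalized eigenpair of `a(u,v) = lam b(u,v)` for all `v`, `b(u,u) = 1`. -/
def IsEigenpair {V : Type*} (a b : V → V → ℝ) (lam : ℝ) (u : V) : Prop :=
  b u u = 1 ∧ ∀ v, a u v = lam * b u v

/-- `(lam, u)` is a `j`-th eigenpair (`j ≥ 1`, eigenvalues in increasing order and counted with
multiplicity): there are `j - 1` eigenpairs with eigenvalues at most `lam` whose eigenfunctions
are `b`-orthonormal and `b`-orthogonal to `u`, and every eigenpair `b`-orthogonal to these has an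
eigenvalue at least `lam`. -/
def IsJthEigenpair {V : Type*} (a b : V → V → ℝ) (j : ℕ) (lam : ℝ) (u : V) : Prop :=
  IsEigenpair a b lam u ∧
    ∃ (μ : Fin (j - 1) → ℝ) (w : Fin (j - 1) → V),
      (∀ i, IsEigenpair a b (μ i) (w i) ∧ μ i ≤ lam ∧ b (w i) u = 0) ∧
      (∀ i k, i ≠ k → b (w i) (w k) = 0) ∧
      ∀ (μ' : ℝ) (w' : V), IsEigenpair a b μ' w' → (∀ i, b (w i) w' = 0) → lam ≤ μ'

end Steklov

end

/-! Writing the corrected eigenvalue as `λ_h² / (λ_h + M)` makes the identity pure algebra, so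
correcting `λ_h` shifts the error by `q = λ_h M / (λ_h + M)`, and `0 ≤ q ≤ M`. Everything else is an
upper bound for `M`.

A `W^{1,∞}` function is a.e. Lipschitz on convex open subsets of `Ω`, in particular inside each
element (`MemW1Inf.exists_ae_lipschitz`, by mollification). Hence `|α - I_0 α| ≤ L h` a.e., while
`C_{h_κ} ≤ h`. Since `α ≥ α₀` and `β ≤ B`, the correction sum is at most a constant times `h²
a_h(u_h, u_h) = h² λ_h` (`correctionSum_le`).

To remove `λ_h` from the bound, the `j`-th discrete eigenvalue is bounded uniformly in the mesh by
the min-max principle (`IsJthEigenpair.exists_rayleigh`). The trial space is spanned by nodal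
interpolants of `j` fixed Lipschitz hat functions of the first coordinate, each dominating on a slab
that carries positive boundary measure (`exists_separating_functions`). Shape regularity bounds
their energy, and a small `h` keeps their boundary values away from zero.

Finally `q = O(h²)` cannot change an `O(h^s)` statement for `s ≤ 2`, and being `o(h^s)` for `s < 2`
it cannot change a `Θ(h^s)` statement either. -/

noncomputable section

namespace Steklov

variable {d : ℕ}

/-! ### Lipschitz bounds for `W^{1,∞}` functions -/

section Mollification

open ContinuousLinearMap
open scoped Convolution

/-- The gradient of the mollification of a function with a weak gradient bounded by `L` is bounded
by `L`. -/
theorem norm_fderiv_mollification_le {Ω : Set (E d)} (hΩ : IsOpen Ω) {u : E d → ℝ}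
    {g : E d → E d} (hu : MemLp u ∞ (volume.restrict Ω))
    (hug : IsWeakGradient Ω u g) {L : ℝ} (hL : ∀ᵐ x ∂(volume.restrict Ω), ‖g x‖ ≤ L) (hL0 : 0 ≤ L)
    (φ : ContDiffBump (0 : E d)) {x : E d} (hx : Metric.closedBall x φ.rOut ⊆ Ω) :
    DifferentiableAt ℝ (φ.normed volume ⋆[lsmul ℝ ℝ, volume] Ω.indicator u) x ∧
      ‖fderiv ℝ (φ.normed volume ⋆[lsmul ℝ ℝ, volume] Ω.indicator u) x‖ ≤ L := by
  set ρ : E d → ℝ := φ.normed volume with hρ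
  have hloc : LocallyIntegrable (Ω.indicator u) volume :=
    ((memLp_indicator_iff_restrict hΩ.measurableSet).2 hu).locallyIntegrable (by simp)
  have hρc : ContDiff ℝ ∞ ρ := φ.contDiff_normed
  have hρs : HasCompactSupport ρ := φ.hasCompactSupport_normed
  have hder := hρs.hasFDerivAt_convolution_left (lsmul ℝ ℝ) (μ := volume)
    (hρc.of_le (by simp)) hloc x
  refine ⟨hder.differentiableAt, ?_⟩
  rw [hder.fderiv]
  -- The reflected kernel is a test function supported in the closed ball around `x`, hence in `Ω`,
  -- so the weak gradient identity applies to it. It turns the derivative of the mollification at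
  -- `x` into the `ψ`-average of `g`.
  set ψ : E d → ℝ := fun t => ρ (x - t) with hψ
  have hψc : ContDiff ℝ ∞ ψ := hρc.comp (contDiff_const.sub contDiff_id)
  have hψs : HasCompactSupport ψ := hρs.comp_homeomorph (Homeomorph.subLeft x)
  have hψsup : tsupport ψ ⊆ Ω := by
    refine subset_trans (closure_minimal ?_ Metric.isClosed_closedBall) hx
    intro t ht
    have : x - t ∈ Function.support ρ := ht
    rw [hρ, φ.support_normed_eq] at this
    rw [Metric.mem_closedBall, dist_comm, dist_eq_norm]
    simpa using (mem_ball_zero_iff.1 this).le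
  have hψi : Integrable ψ := hψc.continuous.integrable_of_hasCompactSupport hψs
  have hψint : ∫ t, ψ t = 1 := by
    have := integral_sub_left_eq_self ρ volume x
    rw [hψ, this]
    exact φ.integral_normed
  have hψ0 : ∀ t, 0 ≤ ψ t := fun t => φ.nonneg_normed _
  have hgr : ∀ t w, inner ℝ w (gradient ψ t) = - fderiv ℝ ρ (x - t) w := by
    intro t w
    rw [real_inner_comm, ← InnerProductSpace.toDual_apply_apply, toDual_gradient]
    have h1 : HasFDerivAt ψ ((fderiv ℝ ρ (x - t)).comp (-ContinuousLinearMap.id ℝ (E d))) t := by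
      have h2 : HasFDerivAt ρ (fderiv ℝ ρ (x - t)) (x - t) :=
        (hρc.differentiable (by simp) _).hasFDerivAt
      exact h2.comp t ((hasFDerivAt_id t).const_sub x)
    rw [h1.fderiv]
    simp
  have hgrad_cont : Continuous (gradient ψ) := by
    unfold gradient
    exact (LinearIsometryEquiv.continuous _).comp (hψc.continuous_fderiv (by simp))
  have hgrad_supp : HasCompactSupport (gradient ψ) := by
    have := hψs.fderiv ℝ
    unfold gradient
    exact this.comp_left (g := (InnerProductSpace.toDual ℝ (E d)).symm) (by simp)
  have hI1 : Integrable (fun t => u t • gradient ψ t) (volume.restrict Ω) :=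
    (hgrad_cont.integrable_of_hasCompactSupport hgrad_supp).integrableOn.smul_of_top_right hu
  refine ContinuousLinearMap.opNorm_le_bound _ hL0 fun w => ?_
  have key : ((fderiv ℝ ρ ⋆[(lsmul ℝ ℝ).precompL (E d), volume] Ω.indicator u) x) w
      = inner ℝ w (∫ t in Ω, ψ t • g t) := by
    have hex : ConvolutionExistsAt (fderiv ℝ ρ) (Ω.indicator u) x ((lsmul ℝ ℝ).precompL (E d))
        volume := (hρs.fderiv ℝ).convolutionExists_left _ (hρc.continuous_fderiv (by simp)) hloc x
    rw [convolution_eq_swap, ContinuousLinearMap.integral_apply (by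
      simpa using hex.integrable_swap)]
    have h3 : inner ℝ w (∫ t in Ω, ψ t • g t) = - ∫ t in Ω, inner ℝ w (u t • gradient ψ t) := by
      rw [← neg_neg (∫ t in Ω, ψ t • g t), ← hug ψ hψc hψs hψsup, inner_neg_right,
        integral_inner hI1]
    rw [h3, ← integral_neg, ← integral_indicator hΩ.measurableSet]
    refine integral_congr_ae (Eventually.of_forall fun t => ?_)
    by_cases ht : t ∈ Ω
    · simp [ht, inner_smul_right, hgr, precompL_apply, mul_comm]
    · simp [ht]
  rw [key]
  refine (norm_inner_le_norm _ _).trans ?_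
  rw [mul_comm]
  refine mul_le_mul_of_nonneg_right ?_ (norm_nonneg _)
  calc ‖∫ t in Ω, ψ t • g t‖ ≤ ∫ t in Ω, L * ψ t := by
        refine norm_integral_le_of_norm_le (hψi.integrableOn.const_mul L) ?_
        filter_upwards [hL] with t ht
        rw [norm_smul, Real.norm_of_nonneg (hψ0 t), mul_comm]
        exact mul_le_mul_of_nonneg_right ht (hψ0 t)
    _ ≤ ∫ t, L * ψ t := setIntegral_le_integral (hψi.const_mul L)
        (Eventually.of_forall fun t => mul_nonneg hL0 (hψ0 t))
    _ = L := by rw [integral_const_mul, hψint, mul_one]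

/-- A function in `W^{1,∞}` is Lipschitz almost everywhere on convex open subsets, with a common
constant. -/
theorem MemW1Inf.exists_ae_lipschitz {Ω : Set (E d)} (hΩ : IsOpen Ω) {u : E d → ℝ}
    (hu : MemW1Inf Ω u) : ∃ L : ℝ, 0 ≤ L ∧ ∀ U : Set (E d), IsOpen U → Convex ℝ U → U ⊆ Ω →
      ∀ᵐ x ∂(volume.restrict U), ∀ᵐ y ∂(volume.restrict U), |u x - u y| ≤ L * dist x y := by
  obtain ⟨hu, g, hg, hug⟩ := hu
  refine ⟨(eLpNormEssSup g (volume.restrict Ω)).toReal, ENNReal.toReal_nonneg, ?_⟩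
  set L := (eLpNormEssSup g (volume.restrict Ω)).toReal
  have hfin : eLpNormEssSup g (volume.restrict Ω) ≠ (⊤ : ℝ≥0∞) := by
    have := hg.2; rw [eLpNorm_exponent_top] at this; exact this.ne
  have hL : ∀ᵐ x ∂(volume.restrict Ω), ‖g x‖ ≤ L := by
    filter_upwards [ae_le_eLpNormEssSup (f := g) (μ := volume.restrict Ω)] with x hx
    have := ENNReal.toReal_mono hfin hx
    simpa using this
  intro U hU hUc hUΩ
  -- The inner radius is half the outer one: a.e. convergence of the mollifications needs a bounded
  -- ratio of radii, here `K = 2`.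
  let φ : ℕ → ContDiffBump (0 : E d) := fun n =>
    ⟨1 / ((n : ℝ) + 1) / 2, 1 / ((n : ℝ) + 1), by positivity, half_lt_self (by positivity)⟩
  have hφ : Tendsto (fun n => (φ n).rOut) atTop (𝓝 0) := tendsto_one_div_add_atTop_nhds_zero_nat
  have hloc : LocallyIntegrable (Ω.indicator u) volume :=
    ((memLp_indicator_iff_restrict hΩ.measurableSet).2 hu).locallyIntegrable (by simp)
  have hlim := ContDiffBump.ae_convolution_tendsto_right_of_locallyIntegrable (K := 2) hφ
    (Eventually.of_forall fun n => by simp only [φ]; linarith) hloc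
  have hpt : ∀ x ∈ U, ∀ y ∈ U,
      Tendsto (fun n => ((φ n).normed volume ⋆[lsmul ℝ ℝ, volume] Ω.indicator u) x) atTop
        (𝓝 (Ω.indicator u x)) →
      Tendsto (fun n => ((φ n).normed volume ⋆[lsmul ℝ ℝ, volume] Ω.indicator u) y) atTop
        (𝓝 (Ω.indicator u y)) → |u x - u y| ≤ L * dist x y := by
    intro x hx y hy hx' hy'
    rw [Set.indicator_of_mem (hUΩ hx)] at hx'
    rw [Set.indicator_of_mem (hUΩ hy)] at hy'
    have hseg : segment ℝ x y ⊆ U := hUc.segment_subset hx hy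
    have hcomp : IsCompact (segment ℝ x y) := by
      rw [← convexHull_pair]; exact (Set.toFinite _).isCompact_convexHull ℝ
    -- Once the mollification radius is below `ε`, the gradient bound holds along the whole segment,
    -- and the mean value inequality passes to the limit.
    obtain ⟨ε, hε, hεU⟩ := hcomp.exists_cthickening_subset_open hU hseg
    refine le_of_tendsto ((hx'.sub hy').abs) ?_
    filter_upwards [hφ.eventually (gt_mem_nhds hε)] with n hn
    have hball : ∀ z ∈ segment ℝ x y, Metric.closedBall z (φ n).rOut ⊆ Ω := fun z hz =>
      ((Metric.closedBall_subset_closedBall hn.le).trans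
        (Metric.closedBall_subset_cthickening hz ε)).trans (hεU.trans hUΩ)
    have := (convex_segment x y).norm_image_sub_le_of_norm_fderiv_le (𝕜 := ℝ)
      (fun z hz => (norm_fderiv_mollification_le hΩ hu hug hL ENNReal.toReal_nonneg (φ n)
        (hball z hz)).1)
      (fun z hz => (norm_fderiv_mollification_le hΩ hu hug hL ENNReal.toReal_nonneg (φ n)
        (hball z hz)).2) (right_mem_segment ℝ x y) (left_mem_segment ℝ x y)
    rwa [← dist_eq_norm x y, Real.norm_eq_abs] at this
  have hlimU := ae_restrict_of_ae (s := U) hlim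
  filter_upwards [hlimU, ae_restrict_mem hU.measurableSet] with x hx hxU
  filter_upwards [hlimU, ae_restrict_mem hU.measurableSet] with y hy hyU
  exact hpt x hxU y hyU hx hy

end Mollification

/-! ### Hausdorff measure of simplices -/

/-- A Lipschitz map increases the Euclidean Hausdorff measure by a bounded factor. -/
theorem euclideanHausdorffMeasure_image_le {X Y : Type*} [EMetricSpace X] [MeasurableSpace X]
    [BorelSpace X] [EMetricSpace Y] [MeasurableSpace Y] [BorelSpace Y] {K : NNReal} {f : X → Y}
    (h : LipschitzWith K f) (n : ℕ) (s : Set X) :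
    Measure.euclideanHausdorffMeasure n (f '' s) ≤
      (K : ℝ≥0∞) ^ n * Measure.euclideanHausdorffMeasure n s := by
  simp only [Measure.euclideanHausdorffMeasure_def, Measure.smul_apply, ENNReal.smul_def,
    smul_eq_mul]
  calc _ ≤ _ * ((K : ℝ≥0∞) ^ (n : ℝ) * Measure.hausdorffMeasure n s) :=
        mul_le_mul_right (h.hausdorffMeasure_image_le (by positivity) s) _
    _ = _ := by rw [ENNReal.rpow_natCast]; ring

/-- A simplex with `n + 1` vertices has finite `n`-dimensional measure. -/
theorem euclideanHausdorffMeasure_convexHull_lt_top {n : ℕ} (e : Finset (E d))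
    (he : e.card = n + 1) :
    Measure.euclideanHausdorffMeasure n (convexHull ℝ (e : Set (E d))) < ⊤ := by
  classical
  obtain ⟨p₀, hp₀⟩ : e.Nonempty := Finset.card_pos.1 (by omega)
  have hcard : (e.erase p₀).card = n := by rw [Finset.card_erase_of_mem hp₀]; omega
  let p : Fin n ≃ (e.erase p₀ : Finset (E d)) := ((e.erase p₀).equivFinOfCardEq hcard).symm
  let A : E n →ₗ[ℝ] E d :=
    (EuclideanSpace.basisFun (Fin n) ℝ).toBasis.constr ℝ (fun i => (p i : E d) - p₀)
  have hA : ∀ i, A (EuclideanSpace.single i 1) = (p i : E d) - p₀ := fun i => by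
    have := (EuclideanSpace.basisFun (Fin n) ℝ).toBasis.constr_basis ℝ
      (fun i => (p i : E d) - p₀) i
    rwa [OrthonormalBasis.coe_toBasis, EuclideanSpace.basisFun_apply] at this
  let f : E n → E d := fun y => p₀ + A.toContinuousLinearMap y
  have hf : LipschitzWith ‖A.toContinuousLinearMap‖₊ f :=
    LipschitzWith.of_dist_le_mul fun x y => by
      simp only [f, dist_add_left]
      exact A.toContinuousLinearMap.lipschitz.dist_le_mul x y
  -- The image of the ball is convex and contains the vertices, which are the images of `0` and of
  -- the standard basis vectors.
  have hsub : convexHull ℝ (e : Set (E d)) ⊆ f '' Metric.closedBall 0 1 := by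
    refine convexHull_min ?_ ?_
    · intro q hq
      by_cases h : q = p₀
      · exact ⟨0, by simp, by simp [f, h]⟩
      · refine ⟨EuclideanSpace.single (p.symm ⟨q, by simpa [h] using hq⟩) 1, by simp, ?_⟩
        simp [f, hA]
    · have := ((convex_closedBall (0 : E n) 1).linear_image A).translate p₀
      rw [Set.image_image] at this
      exact this
  calc _ ≤ Measure.euclideanHausdorffMeasure n (f '' Metric.closedBall 0 1) :=
        measure_mono hsub
    _ ≤ _ := euclideanHausdorffMeasure_image_le hf n _
    _ < ⊤ := by
      rw [EuclideanSpace.euclideanHausdorffMeasure_eq_volume]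
      exact ENNReal.mul_lt_top (by simp) measure_closedBall_lt_top

/-! ### Geometry of the mesh -/

namespace Mesh

variable {Ω : Set (E d)} (T : Mesh Ω)

theorem mem_faces (κ : T.cells) : (κ : Finset (E d)) ∈ T.complex.faces := by
  have := κ.2
  simp only [cells, Finset.mem_filter, Set.Finite.mem_toFinset] at this
  exact this.1

theorem card_cell (κ : T.cells) : (κ : Finset (E d)).card = d + 1 := by
  have := κ.2
  simp only [cells, Finset.mem_filter] at this
  exact this.2

/-- The vertices of an element, as an affine basis of the space. -/
def cellBasis (κ : T.cells) : AffineBasis (κ : Finset (E d)) ℝ (E d) where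
  toFun := Subtype.val
  ind' := T.complex.indep (T.mem_faces κ)
  tot' := by
    rw [(T.complex.indep (T.mem_faces κ)).affineSpan_eq_top_iff_card_eq_finrank_add_one]
    simp [T.card_cell κ]

@[simp]
theorem cellBasis_apply (κ : T.cells) (p : (κ : Finset (E d))) : T.cellBasis κ p = p := rfl

theorem range_cellBasis (κ : T.cells) :
    Set.range (T.cellBasis κ) = ((κ : Finset (E d)) : Set (E d)) := by
  have : ⇑(T.cellBasis κ) = Subtype.val := rfl
  rw [this, Subtype.range_coe_subtype]; rfl

theorem body_eq (κ : T.cells) : T.body κ = {x | ∀ p, 0 ≤ (T.cellBasis κ).coord p x} := by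
  rw [body, ← T.range_cellBasis, AffineBasis.convexHull_eq_nonneg_coord]

theorem interior_body_eq (κ : T.cells) :
    interior (T.body κ) = {x | ∀ p, 0 < (T.cellBasis κ).coord p x} := by
  rw [body, ← T.range_cellBasis, AffineBasis.interior_convexHull]

theorem convex_body (κ : T.cells) : Convex ℝ (T.body κ) := convex_convexHull ℝ _

theorem isCompact_body (κ : T.cells) : IsCompact (T.body κ) :=
  (Finset.finite_toSet _).isCompact_convexHull ℝ

theorem measurableSet_body (κ : T.cells) : MeasurableSet (T.body κ) :=
  (T.isCompact_body κ).isClosed.measurableSet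

theorem subset_body (κ : T.cells) : ((κ : Finset (E d)) : Set (E d)) ⊆ T.body κ :=
  subset_convexHull ℝ _

theorem interior_body_nonempty (κ : T.cells) : (interior (T.body κ)).Nonempty := by
  rw [body, interior_convexHull_nonempty_iff_affineSpan_eq_top, ← T.range_cellBasis]
  exact (T.cellBasis κ).tot

theorem body_subset_closure (κ : T.cells) : T.body κ ⊆ closure Ω := by
  rw [← T.space_eq]
  exact Geometry.SimplicialComplex.convexHull_subset_space (T.mem_faces κ)

theorem interior_body_subset (hΩ : interior (closure Ω) = Ω) (κ : T.cells) :
    interior (T.body κ) ⊆ Ω :=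
  (interior_mono (T.body_subset_closure κ)).trans hΩ.subset

theorem interior_body_ae_eq (κ : T.cells) : interior (T.body κ) =ᵐ[volume] T.body κ :=
  interior_ae_eq_of_null_frontier ((T.convex_body κ).addHaar_frontier volume)

theorem restrict_interior_body (κ : T.cells) :
    volume.restrict (interior (T.body κ)) = volume.restrict (T.body κ) :=
  Measure.restrict_congr_set (T.interior_body_ae_eq κ)

/-- Transfers a.e. statements from `Ω` to an element. Only the frontier of the element can leave
`Ω`, and the frontier of a convex set is null. -/
theorem restrict_body_le (hΩ : interior (closure Ω) = Ω) (κ : T.cells) :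
    volume.restrict (T.body κ) ≤ volume.restrict Ω := by
  rw [← T.restrict_interior_body]
  exact Measure.restrict_mono (T.interior_body_subset hΩ κ) le_rfl

theorem volume_body_pos (κ : T.cells) : 0 < volume (T.body κ) :=
  (isOpen_interior.measure_pos volume (T.interior_body_nonempty κ)).trans_le
    (measure_mono interior_subset)

instance (κ : T.cells) : IsFiniteMeasure (volume.restrict (T.body κ)) :=
  ⟨by simpa using (T.isCompact_body κ).measure_lt_top⟩

instance (κ : T.cells) : NeZero (volume.restrict (T.body κ)) :=
  ⟨by simpa [Measure.restrict_eq_zero] using (T.volume_body_pos κ).ne'⟩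

theorem closure_eq_iUnion_body : closure Ω = ⋃ κ : T.cells, T.body κ := by
  refine subset_antisymm ?_ (Set.iUnion_subset T.body_subset_closure)
  rw [← T.space_eq]
  intro x hx
  obtain ⟨s, hs, hxs⟩ := Geometry.SimplicialComplex.mem_space_iff.1 hx
  obtain ⟨t, ht, hst, htc⟩ := T.pure s hs
  refine Set.mem_iUnion.2 ⟨⟨t, ?_⟩, convexHull_mono (by exact_mod_cast hst) hxs⟩
  simp only [cells, Finset.mem_filter, Set.Finite.mem_toFinset]
  exact ⟨ht, htc⟩

theorem coord_eq_zero_of_mem_convexHull (κ : T.cells) (p : (κ : Finset (E d))) {s : Set (E d)}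
    (hs : ∀ q ∈ s, q ∈ (κ : Finset (E d))) (hp : (p : E d) ∉ s) {x : E d}
    (hx : x ∈ convexHull ℝ s) : (T.cellBasis κ).coord p x = 0 := by
  have hconv : Convex ℝ ((T.cellBasis κ).coord p ⁻¹' {0}) :=
    (convex_singleton (0 : ℝ)).affine_preimage _
  have hsub : s ⊆ (T.cellBasis κ).coord p ⁻¹' {0} := by
    intro q hq
    have hne : p ≠ ⟨q, hs q hq⟩ := by
      rintro rfl
      exact hp hq
    have := (T.cellBasis κ).coord_apply_ne hne
    rwa [cellBasis_apply] at this
  exact convexHull_min hsub hconv hx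

/-- Some vertex `p` of `κ` is not a vertex of `κ'`. By conformity a common point lies in the hull of
the shared vertices, where the barycentric coordinate of `p` vanishes, but in the interior of `κ` it
is positive. -/
theorem disjoint_interior_body {κ κ' : T.cells} (h : κ ≠ κ') :
    Disjoint (interior (T.body κ)) (interior (T.body κ')) := by
  have hne : ¬ (κ : Finset (E d)) ⊆ κ' := fun hsub =>
    h (Subtype.ext (Finset.eq_of_subset_of_card_le hsub (by rw [T.card_cell, T.card_cell])))
  obtain ⟨p, hp, hp'⟩ := Finset.not_subset.1 hne
  rw [Set.disjoint_left]
  intro x hx hx'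
  have hmem : x ∈ convexHull ℝ (((κ : Finset (E d)) : Set (E d)) ∩ (κ' : Finset (E d))) :=
    T.complex.inter_subset_convexHull (T.mem_faces κ) (T.mem_faces κ')
      ⟨interior_subset hx, interior_subset hx'⟩
  have h0 := T.coord_eq_zero_of_mem_convexHull κ ⟨p, hp⟩ (fun q hq => hq.1)
    (fun hh => hp' hh.2) hmem
  rw [T.interior_body_eq] at hx
  exact (hx ⟨p, hp⟩).ne' h0

theorem sum_volume_body_le (hΩ : interior (closure Ω) = Ω) :
    ∑ κ : T.cells, volume (T.body κ) ≤ volume Ω := by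
  calc ∑ κ : T.cells, volume (T.body κ) = ∑ κ : T.cells, volume (interior (T.body κ)) :=
        Finset.sum_congr rfl fun κ _ => (measure_congr (T.interior_body_ae_eq κ)).symm
    _ = volume (⋃ κ : T.cells, interior (T.body κ)) := by
        rw [measure_iUnion (fun κ κ' h => T.disjoint_interior_body h)
          (fun κ => isOpen_interior.measurableSet), tsum_fintype]
    _ ≤ volume Ω := measure_mono (Set.iUnion_subset (T.interior_body_subset hΩ))

/-- At a non-interior point some barycentric coordinate vanishes, so the point is a convex
combination of the other vertices. -/
theorem body_subset_interior_union (κ : T.cells) :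
    T.body κ ⊆ interior (T.body κ) ∪
      ⋃ p : (κ : Finset (E d)), convexHull ℝ (((κ : Finset (E d)).erase p : Finset (E d)) :
        Set (E d)) := by
  classical
  intro x hx
  by_cases hx' : x ∈ interior (T.body κ)
  · exact Or.inl hx'
  right
  rw [T.interior_body_eq] at hx'
  rw [T.body_eq] at hx
  simp only [Set.mem_ofPred_eq, not_forall, not_lt] at hx hx'
  obtain ⟨p, hp⟩ := hx'
  have hp0 : (T.cellBasis κ).coord p x = 0 := le_antisymm hp (hx p)
  refine Set.mem_iUnion.2 ⟨p, ?_⟩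
  have hsum := (T.cellBasis κ).sum_coord_apply_eq_one x
  have hcomb := (T.cellBasis κ).linear_combination_coord_eq_self x
  rw [← Finset.add_sum_erase _ _ (Finset.mem_univ p), hp0, zero_add] at hsum
  rw [← Finset.add_sum_erase _ _ (Finset.mem_univ p), hp0, zero_smul, zero_add] at hcomb
  rw [← hcomb]
  refine (convex_convexHull ℝ _).sum_mem (fun q _ => hx q) hsum fun q hq => ?_
  refine subset_convexHull ℝ _ ?_
  simp only [Finset.coe_erase, cellBasis_apply]
  exact ⟨q.2, fun h => (Finset.ne_of_mem_erase hq) (Subtype.ext h)⟩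

/-- Element interiors lie in the open set `Ω`, so `∂Ω` is covered by the finitely many facets of
elements, each of finite measure. This makes continuous functions integrable on the boundary part of
an element. -/
theorem isFiniteMeasure_surfaceMeasure (T : Mesh Ω) (hd : 0 < d) (ho : IsOpen Ω)
    (hΩ : interior (closure Ω) = Ω) : IsFiniteMeasure (surfaceMeasure Ω) := by
  classical
  refine ⟨?_⟩
  rw [surfaceMeasure, Measure.restrict_apply_univ]
  have hsub : frontier Ω ⊆ ⋃ κ : T.cells, ⋃ p : (κ : Finset (E d)),
      convexHull ℝ (((κ : Finset (E d)).erase p : Finset (E d)) : Set (E d)) := by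
    rw [ho.frontier_eq]
    rintro x ⟨hx, hxΩ⟩
    rw [T.closure_eq_iUnion_body] at hx
    obtain ⟨κ, hκ⟩ := Set.mem_iUnion.1 hx
    rcases T.body_subset_interior_union κ hκ with h | h
    · exact absurd (T.interior_body_subset hΩ κ h) hxΩ
    · exact Set.mem_iUnion.2 ⟨κ, h⟩
  refine (measure_mono hsub).trans_lt ?_
  refine (measure_iUnion_fintype_le _ _).trans_lt (ENNReal.sum_lt_top.2 fun κ _ => ?_)
  refine (measure_iUnion_fintype_le _ _).trans_lt (ENNReal.sum_lt_top.2 fun p _ => ?_)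
  refine euclideanHausdorffMeasure_convexHull_lt_top _ ?_
  rw [Finset.card_erase_of_mem p.2, T.card_cell]
  omega

end Mesh

/-! ### Affine functions -/

/-- The constant gradient of an affine function. -/
def affGrad : (E d →ᵃ[ℝ] ℝ) →ₗ[ℝ] E d where
  toFun f := (InnerProductSpace.toDual ℝ (E d)).symm f.linear.toContinuousLinearMap
  map_add' f g := by simp
  map_smul' c f := by simp

theorem inner_affGrad (f : E d →ᵃ[ℝ] ℝ) (x y : E d) :
    inner ℝ (affGrad f) (x - y) = f x - f y := by
  have h := f.linearMap_vsub x y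
  simp only [vsub_eq_sub] at h
  rw [affGrad, LinearMap.coe_mk, AddHom.coe_mk, InnerProductSpace.toDual_symm_apply]
  exact h

theorem gradient_affineMap (f : E d →ᵃ[ℝ] ℝ) (x : E d) : gradient f x = affGrad f := by
  have h : HasGradientAt f (affGrad f) x := by
    rw [hasGradientAt_iff_hasFDerivAt]
    have h1 : (InnerProductSpace.toDual ℝ (E d)) (affGrad f) = f.linear.toContinuousLinearMap := by
      simp [affGrad]
    have h2 : (f : E d → ℝ) = fun y => f.linear.toContinuousLinearMap y + f 0 := by
      funext y
      exact congrFun f.decomp y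
    rw [h1, h2]
    exact f.linear.toContinuousLinearMap.hasFDerivAt.add_const _
  exact h.gradient

theorem continuous_affineMap (f : E d →ᵃ[ℝ] ℝ) : Continuous f :=
  f.continuous_of_finiteDimensional

theorem continuous_affineMap_mul (f g : E d →ᵃ[ℝ] ℝ) : Continuous fun x => f x * g x :=
  (continuous_affineMap f).mul (continuous_affineMap g)

/-- An affine function on a ball of radius `r` oscillates by at least `2 r` times the length of its
gradient. -/
theorem norm_affGrad_mul_le (f : E d →ᵃ[ℝ] ℝ) {s : Set (E d)} {x : E d} {r w : ℝ} (hr : 0 ≤ r)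
    (hs : Metric.closedBall x r ⊆ s) (hw0 : 0 ≤ w) (hw : ∀ y ∈ s, f y - f x ≤ w) :
    ‖affGrad f‖ * r ≤ w := by
  by_cases h0 : affGrad f = 0
  · simpa [h0] using hw0
  have hn : 0 < ‖affGrad f‖ := norm_pos_iff.2 h0
  -- The point of the ball where `f` is largest: distance `r` from the center along the gradient.
  set y := x + (r / ‖affGrad f‖) • affGrad f with hy
  have hyx : y - x = (r / ‖affGrad f‖) • affGrad f := by simp [hy]
  have hmem : y ∈ Metric.closedBall x r := by
    rw [Metric.mem_closedBall, dist_eq_norm, hyx, norm_smul, Real.norm_of_nonneg (by positivity),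
      div_mul_cancel₀ _ hn.ne']
  have h1 := hw y (hs hmem)
  rw [← inner_affGrad, hyx, inner_smul_right, real_inner_self_eq_norm_sq] at h1
  calc _ = r / ‖affGrad f‖ * ‖affGrad f‖ ^ 2 := by field_simp
    _ ≤ w := h1

namespace Mesh

variable {Ω : Set (E d)} (T : Mesh Ω)

theorem cellDiam_nonneg (κ : T.cells) : 0 ≤ T.cellDiam κ := Metric.diam_nonneg

theorem cellDiam_le_meshSize (κ : T.cells) : T.cellDiam κ ≤ T.meshSize :=
  le_ciSup (Set.finite_range T.cellDiam).bddAbove κ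

theorem meshSize_nonneg : 0 ≤ T.meshSize := Real.iSup_nonneg T.cellDiam_nonneg

theorem dist_le_cellDiam (κ : T.cells) {x y : E d} (hx : x ∈ T.body κ) (hy : y ∈ T.body κ) :
    dist x y ≤ T.cellDiam κ :=
  Metric.dist_le_diam_of_mem (T.isCompact_body κ).isBounded hx hy

theorem cellDiam_pos (hd : 0 < d) (κ : T.cells) : 0 < T.cellDiam κ := by
  obtain ⟨p, hp, q, hq, hpq⟩ := Finset.one_lt_card.1
    (show 1 < (κ : Finset (E d)).card by rw [T.card_cell]; omega)
  exact (dist_pos.2 hpq).trans_le (T.dist_le_cellDiam κ (T.subset_body κ hp) (T.subset_body κ hq))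

/-! ### The discrete forms and the interpolated coefficient -/

section Forms

variable {α β : E d → ℝ}

theorem integrableOn_body_mul {f : E d → ℝ} (κ : T.cells)
    (hβ : MemLp β ∞ (volume.restrict (T.body κ))) (hf : Continuous f) :
    IntegrableOn (fun x => β x * f x) (T.body κ) := by
  have hβ1 : IntegrableOn β (T.body κ) := hβ.integrable (by simp)
  exact hβ1.mul_continuousOn hf.continuousOn (T.isCompact_body κ)

theorem aForm_eq (u v : T.crSpace) (hα : ∀ κ, MemLp α ∞ (volume.restrict (T.body κ)))
    (hβ : ∀ κ, MemLp β ∞ (volume.restrict (T.body κ))) :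
    T.aForm α β u v = ∑ κ : T.cells,
      (inner ℝ (affGrad (u.1 κ)) (affGrad (v.1 κ)) * ∫ x in T.body κ, α x) +
      ∑ κ : T.cells, ∫ x in T.body κ, β x * (u.1 κ x * v.1 κ x) := by
  rw [aForm, ← Finset.sum_add_distrib]
  refine Finset.sum_congr rfl fun κ _ => ?_
  simp only [gradient_affineMap, mul_assoc]
  rw [integral_add, integral_mul_const, mul_comm]
  · exact T.integrableOn_body_mul κ (hα κ) continuous_const
  · exact T.integrableOn_body_mul κ (hβ κ)
      (continuous_affineMap_mul _ _)

theorem aForm_comm (u v : T.crSpace) : T.aForm α β u v = T.aForm α β v u := by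
  unfold aForm
  refine Finset.sum_congr rfl fun κ _ => integral_congr_ae (Eventually.of_forall fun x => ?_)
  simp only [real_inner_comm, mul_assoc, mul_comm (u.1 κ x)]

theorem bForm_comm (u v : T.crSpace) : T.bForm u v = T.bForm v u := by
  unfold bForm
  simp only [mul_comm]

/-- The discrete form `a_h` as a bilinear map. -/
def aBilin (hα : ∀ κ : T.cells, MemLp α ∞ (volume.restrict (T.body κ)))
    (hβ : ∀ κ : T.cells, MemLp β ∞ (volume.restrict (T.body κ))) :
    T.crSpace →ₗ[ℝ] T.crSpace →ₗ[ℝ] ℝ :=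
  have hadd : ∀ u u' v, T.aForm α β (u + u') v = T.aForm α β u v + T.aForm α β u' v := by
    intro u u' v
    simp only [T.aForm_eq _ _ hα hβ]
    have : ∀ κ : T.cells, ∫ x in T.body κ, β x * ((u + u').1 κ x * v.1 κ x) =
        (∫ x in T.body κ, β x * (u.1 κ x * v.1 κ x)) +
          ∫ x in T.body κ, β x * (u'.1 κ x * v.1 κ x) := by
      intro κ
      rw [← integral_add (T.integrableOn_body_mul κ (hβ κ)
          (continuous_affineMap_mul _ _))
        (T.integrableOn_body_mul κ (hβ κ)
          (continuous_affineMap_mul _ _))]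
      refine integral_congr_ae (Eventually.of_forall fun x => ?_)
      simp only [Submodule.coe_add, Pi.add_apply, AffineMap.coe_add]
      ring
    simp only [this]
    simp only [Submodule.coe_add, Pi.add_apply, map_add, inner_add_left, add_mul,
      Finset.sum_add_distrib]
    ring
  have hsmul : ∀ (c : ℝ) u v, T.aForm α β (c • u) v = c * T.aForm α β u v := by
    intro c u v
    simp only [T.aForm_eq _ _ hα hβ]
    have : ∀ κ : T.cells, ∫ x in T.body κ, β x * ((c • u).1 κ x * v.1 κ x) =
        c * ∫ x in T.body κ, β x * (u.1 κ x * v.1 κ x) := by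
      intro κ
      rw [← integral_const_mul]
      refine integral_congr_ae (Eventually.of_forall fun x => ?_)
      simp only [Submodule.coe_smul, Pi.smul_apply, AffineMap.coe_smul, smul_eq_mul]
      ring
    simp only [this]
    simp only [Submodule.coe_smul, Pi.smul_apply, map_smul, real_inner_smul_left, mul_assoc,
      mul_add, Finset.mul_sum]
  LinearMap.mk₂ ℝ (T.aForm α β) hadd hsmul
    (fun u v v' => by rw [T.aForm_comm, hadd, T.aForm_comm v, T.aForm_comm v'])
    (fun c u v => by rw [T.aForm_comm, hsmul, T.aForm_comm v, smul_eq_mul])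

@[simp]
theorem aBilin_apply (hα : ∀ κ : T.cells, MemLp α ∞ (volume.restrict (T.body κ)))
    (hβ : ∀ κ : T.cells, MemLp β ∞ (volume.restrict (T.body κ))) (u v : T.crSpace) :
    T.aBilin hα hβ u v = T.aForm α β u v := rfl

theorem integrableOn_body_surface [IsFiniteMeasure (surfaceMeasure Ω)] {f : E d → ℝ}
    (κ : T.cells) (hf : Continuous f) : IntegrableOn f (T.body κ) (surfaceMeasure Ω) :=
  hf.continuousOn.integrableOn_compact (T.isCompact_body κ)

/-- The discrete boundary form `b` as a bilinear map. -/
def bBilin [IsFiniteMeasure (surfaceMeasure Ω)] : T.crSpace →ₗ[ℝ] T.crSpace →ₗ[ℝ] ℝ :=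
  have hadd : ∀ u u' v, T.bForm (u + u') v = T.bForm u v + T.bForm u' v := by
    intro u u' v
    unfold bForm
    rw [← Finset.sum_add_distrib]
    refine Finset.sum_congr rfl fun κ _ => ?_
    rw [← integral_add (T.integrableOn_body_surface κ
          (continuous_affineMap_mul _ _))
        (T.integrableOn_body_surface κ
          (continuous_affineMap_mul _ _))]
    refine integral_congr_ae (Eventually.of_forall fun x => ?_)
    simp only [Submodule.coe_add, Pi.add_apply, AffineMap.coe_add]
    ring
  have hsmul : ∀ (c : ℝ) u v, T.bForm (c • u) v = c * T.bForm u v := by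
    intro c u v
    unfold bForm
    rw [Finset.mul_sum]
    refine Finset.sum_congr rfl fun κ _ => ?_
    rw [← integral_const_mul]
    refine integral_congr_ae (Eventually.of_forall fun x => ?_)
    simp only [Submodule.coe_smul, Pi.smul_apply, AffineMap.coe_smul, smul_eq_mul]
    ring
  LinearMap.mk₂ ℝ T.bForm hadd hsmul
    (fun u v v' => by rw [T.bForm_comm, hadd, T.bForm_comm v, T.bForm_comm v'])
    (fun c u v => by rw [T.bForm_comm, hsmul, T.bForm_comm v, smul_eq_mul])

@[simp]
theorem bBilin_apply [IsFiniteMeasure (surfaceMeasure Ω)] (u v : T.crSpace) :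
    T.bBilin u v = T.bForm u v := rfl

variable {α₀ β₀ : ℝ}

theorem cellEnergy_nonneg (hα₀ : 0 < α₀) (hβ₀ : 0 < β₀) (κ : T.cells)
    (hαlow : ∀ᵐ x ∂(volume.restrict (T.body κ)), α₀ ≤ α x)
    (hβlow : ∀ᵐ x ∂(volume.restrict (T.body κ)), β₀ ≤ β x) (f : E d →ᵃ[ℝ] ℝ) :
    0 ≤ ∫ x in T.body κ, (α x * inner ℝ (gradient f x) (gradient f x) + β x * f x * f x) := by
  refine integral_nonneg_of_ae ?_
  filter_upwards [hαlow, hβlow] with x hx hx'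
  have h1 : 0 ≤ α x := hα₀.le.trans hx
  have h2 : 0 ≤ β x := hβ₀.le.trans hx'
  have h3 : 0 ≤ inner ℝ (gradient f x) (gradient f x) := real_inner_self_nonneg
  have h4 := mul_nonneg h2 (mul_self_nonneg (f x))
  simp only [Pi.zero_apply, mul_assoc]
  positivity

/-- If the energy vanishes, so does each element's share. Its integrand dominates `β₀ u²`, so `u` is
zero a.e. on the element, and an affine function vanishing on a nonempty open set is zero. -/
theorem aForm_self_pos (hα₀ : 0 < α₀) (hβ₀ : 0 < β₀)
    (hα : ∀ κ : T.cells, MemLp α ∞ (volume.restrict (T.body κ)))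
    (hβ : ∀ κ : T.cells, MemLp β ∞ (volume.restrict (T.body κ)))
    (hαlow : ∀ κ : T.cells, ∀ᵐ x ∂(volume.restrict (T.body κ)), α₀ ≤ α x)
    (hβlow : ∀ κ : T.cells, ∀ᵐ x ∂(volume.restrict (T.body κ)), β₀ ≤ β x) {u : T.crSpace}
    (hu : u ≠ 0) : 0 < T.aForm α β u u := by
  by_contra hle
  have hsum : T.aForm α β u u = 0 := le_antisymm (not_lt.1 hle)
    (Finset.sum_nonneg fun κ _ => T.cellEnergy_nonneg hα₀ hβ₀ κ (hαlow κ) (hβlow κ) _)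
  have hzero := (Finset.sum_eq_zero_iff_of_nonneg fun κ _ =>
    T.cellEnergy_nonneg hα₀ hβ₀ κ (hαlow κ) (hβlow κ) _).1 hsum
  apply hu
  ext1
  funext κ
  have h0 := hzero κ (Finset.mem_univ κ)
  have hint : IntegrableOn (fun x => α x * inner ℝ (gradient (u.1 κ) x) (gradient (u.1 κ) x) +
      β x * u.1 κ x * u.1 κ x) (T.body κ) := by
    simp only [gradient_affineMap, mul_assoc]
    exact (T.integrableOn_body_mul κ (hα κ) continuous_const).add
      (T.integrableOn_body_mul κ (hβ κ) (continuous_affineMap_mul _ _))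
  have hae : ∀ᵐ x ∂(volume.restrict (T.body κ)), 0 ≤ α x * inner ℝ (gradient (u.1 κ) x)
      (gradient (u.1 κ) x) + β x * u.1 κ x * u.1 κ x ∧ β₀ * (u.1 κ x * u.1 κ x) ≤
      α x * inner ℝ (gradient (u.1 κ) x) (gradient (u.1 κ) x) + β x * u.1 κ x * u.1 κ x := by
    filter_upwards [hαlow κ, hβlow κ] with x hx hx'
    have h1 : 0 ≤ α x := hα₀.le.trans hx
    have h3 : 0 ≤ inner ℝ (gradient (u.1 κ) x) (gradient (u.1 κ) x) := real_inner_self_nonneg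
    have h5 := mul_nonneg h1 h3
    have h4 := mul_le_mul_of_nonneg_right hx' (mul_self_nonneg (u.1 κ x))
    have h6 := mul_nonneg hβ₀.le (mul_self_nonneg (u.1 κ x))
    rw [mul_assoc (β x)]
    constructor <;> linarith
  rw [setIntegral_eq_zero_iff_of_nonneg_ae (hae.mono fun x hx => hx.1) hint] at h0
  have hz : (u.1 κ : E d → ℝ) =ᵐ[volume.restrict (interior (T.body κ))] fun _ => 0 := by
    rw [T.restrict_interior_body]
    filter_upwards [h0, hae] with x hx hx'
    have h1 : β₀ * (u.1 κ x * u.1 κ x) ≤ 0 := hx'.2.trans_eq hx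
    have h2 : u.1 κ x * u.1 κ x ≤ 0 := by
      by_contra h
      exact absurd h1 (not_le.2 (mul_pos hβ₀ (not_le.1 h)))
    exact mul_self_eq_zero.1 (le_antisymm h2 (mul_self_nonneg _))
  have heq := Measure.eqOn_open_of_ae_eq hz isOpen_interior
    (continuous_affineMap _).continuousOn continuousOn_const
  have hspan := isOpen_interior.affineSpan_eq_top (T.interior_body_nonempty κ)
  exact AffineMap.ext_on hspan (fun x hx => heq hx)

/-- An interpolated value on an element differs little from the values of the coefficient. -/
theorem IsPiecewiseConstInterp.ae_abs_sub_le {T : Mesh Ω} {c : T.cells → ℝ}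
    (hc : T.IsPiecewiseConstInterp α c) {κ : T.cells} {w : ℝ}
    (hw : ∀ᵐ x ∂(volume.restrict (T.body κ)), ∀ᵐ y ∂(volume.restrict (T.body κ)),
      |α x - α y| ≤ w) :
    ∀ᵐ x ∂(volume.restrict (T.body κ)), |α x - c κ| ≤ w := by
  filter_upwards [hw] with x hx
  -- One good point `x` confines `α` a.e. to `[α x - w, α x + w]`. This boundedness is needed for
  -- the real-valued `essInf` and `essSup` to be meaningful.
  have hlow : IsBoundedUnder (· ≥ ·) (ae (volume.restrict (T.body κ))) α :=
    isBoundedUnder_of_eventually_ge (a := α x - w)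
      (hx.mono fun y hy => by linarith [(abs_le.1 hy).2])
  have hup : IsBoundedUnder (· ≤ ·) (ae (volume.restrict (T.body κ))) α :=
    isBoundedUnder_of_eventually_le (a := α x + w)
      (hx.mono fun y hy => by linarith [(abs_le.1 hy).1])
  have h1 : essSup α (volume.restrict (T.body κ)) ≤ α x + w := by
    refine essSup_le_of_ae_le (α x + w) ?_ hlow.isCoboundedUnder_le
    filter_upwards [hx] with y hy
    linarith [(abs_le.1 hy).1]
  have h2 : α x - w ≤ essInf α (volume.restrict (T.body κ)) := by
    refine le_essInf_of_ae_le (α x - w) ?_ hup.isCoboundedUnder_ge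
    filter_upwards [hx] with y hy
    linarith [(abs_le.1 hy).2]
  have := hc κ
  rw [abs_le]
  constructor <;> linarith [this.1, this.2]

end Forms

end Mesh

/-! ### Bound of the correction by the energy -/

namespace Mesh

variable {Ω : Set (E d)} (T : Mesh Ω) {α β : E d → ℝ} {α₀ β₀ : ℝ}

theorem sq_normL2 {F : Type*} [NormedAddCommGroup F] (κ : T.cells) (f : E d → F) :
    T.normL2 κ f ^ 2 = ∫ x in T.body κ, ‖f x‖ ^ 2 :=
  Real.sq_sqrt (integral_nonneg fun _ => by positivity)

theorem interpConst_nonneg (κ : T.cells) : 0 ≤ T.interpConst κ :=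
  mul_nonneg (by split_ifs <;> norm_num) (T.cellDiam_nonneg κ)

/-- Of the numerical constants, only that they are at most `1` matters for this bound. -/
theorem interpConst_le_meshSize (κ : T.cells) : T.interpConst κ ≤ T.meshSize := by
  refine le_trans ?_ (T.cellDiam_le_meshSize κ)
  refine mul_le_of_le_one_left (T.cellDiam_nonneg κ) ?_
  split_ifs <;> norm_num

theorem correctionSum_nonneg (c : T.cells → ℝ) (u : T.crSpace) :
    0 ≤ T.correctionSum α β c u :=
  Finset.sum_nonneg fun _ _ => sq_nonneg _

/-- The correction is bounded by the energy times the square of the mesh size. -/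
theorem correctionSum_le {L B : ℝ} (hα₀ : 0 < α₀) (hβ₀ : 0 < β₀)
    (hα : ∀ κ : T.cells, MemLp α ∞ (volume.restrict (T.body κ)))
    (hβ : ∀ κ : T.cells, MemLp β ∞ (volume.restrict (T.body κ)))
    (hαlow : ∀ κ : T.cells, ∀ᵐ x ∂(volume.restrict (T.body κ)), α₀ ≤ α x)
    (hβlow : ∀ κ : T.cells, ∀ᵐ x ∂(volume.restrict (T.body κ)), β₀ ≤ β x)
    (hB : ∀ κ : T.cells, ∀ᵐ x ∂(volume.restrict (T.body κ)), β x ≤ B) (hB0 : 0 ≤ B)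
    {c : T.cells → ℝ} (hc : ∀ κ : T.cells, ∀ᵐ x ∂(volume.restrict (T.body κ)),
      |α x - c κ| ≤ L * T.meshSize) (u : T.crSpace) :
    T.correctionSum α β c u ≤ 2 * (L ^ 2 / α₀ + B) * T.meshSize ^ 2 * T.aForm α β u u := by
  unfold correctionSum aForm
  rw [Finset.mul_sum]
  refine Finset.sum_le_sum fun κ _ => ?_
  simp only [gradient_affineMap]
  set h := T.meshSize
  set G := affGrad (u.1 κ)
  have hI1 : IntegrableOn (fun x => α x * inner ℝ G G) (T.body κ) :=
    T.integrableOn_body_mul κ (hα κ) continuous_const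
  have hI2 : IntegrableOn (fun x => β x * u.1 κ x * u.1 κ x) (T.body κ) := by
    simp only [mul_assoc]
    exact T.integrableOn_body_mul κ (hβ κ) (continuous_affineMap_mul _ _)
  rw [integral_add hI1 hI2]
  have hP : 0 ≤ ∫ x in T.body κ, α x * inner ℝ G G := by
    refine integral_nonneg_of_ae ?_
    filter_upwards [hαlow κ] with x hx
    exact mul_nonneg (hα₀.le.trans hx) real_inner_self_nonneg
  have hQ : 0 ≤ ∫ x in T.body κ, β x * u.1 κ x * u.1 κ x := by
    refine integral_nonneg_of_ae ?_
    filter_upwards [hβlow κ] with x hx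
    rw [Pi.zero_apply, mul_assoc]
    exact mul_nonneg (hβ₀.le.trans hx) (mul_self_nonneg _)
  have hA : T.normL2 κ (fun x => (α x - c κ) • G) ^ 2 ≤
      h ^ 2 * (L ^ 2 / α₀ * ∫ x in T.body κ, α x * inner ℝ G G) := by
    rw [sq_normL2, ← mul_assoc, ← integral_const_mul]
    refine integral_mono_of_nonneg (Eventually.of_forall fun x => by positivity)
      (hI1.const_mul _) ?_
    filter_upwards [hαlow κ, hc κ] with x hx hcx
    rw [norm_smul, mul_pow, Real.norm_eq_abs, real_inner_self_eq_norm_sq]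
    have h1 : |α x - c κ| ^ 2 ≤ (L * h) ^ 2 := pow_le_pow_left₀ (abs_nonneg _) hcx 2
    calc _ ≤ (L * h) ^ 2 * ‖G‖ ^ 2 := mul_le_mul_of_nonneg_right h1 (by positivity)
      _ = h ^ 2 * (L ^ 2 / α₀) * (α₀ * ‖G‖ ^ 2) := by field_simp
      _ ≤ _ := by gcongr
  -- In `β² u²` one factor `β` is bounded by `B`; the other is kept as the weight of the energy.
  have hBn : T.normL2 κ (fun x => β x * u.1 κ x) ^ 2 ≤
      B * ∫ x in T.body κ, β x * u.1 κ x * u.1 κ x := by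
    rw [sq_normL2, ← integral_const_mul]
    refine integral_mono_of_nonneg (Eventually.of_forall fun x => by positivity)
      (hI2.const_mul _) ?_
    filter_upwards [hβlow κ, hB κ] with x hx hBx
    rw [norm_mul, mul_pow, Real.norm_eq_abs, Real.norm_eq_abs, sq_abs, sq_abs]
    have h1 : 0 ≤ β x := hβ₀.le.trans hx
    have h2 : 0 ≤ β x * (u.1 κ x) ^ 2 := by positivity
    calc _ = β x * (β x * (u.1 κ x) ^ 2) := by ring
      _ ≤ B * (β x * (u.1 κ x) ^ 2) := mul_le_mul_of_nonneg_right hBx h2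
      _ = _ := by ring
  set a := T.normL2 κ (fun x => (α x - c κ) • G)
  set b := T.normL2 κ (fun x => β x * u.1 κ x)
  set P := ∫ x in T.body κ, α x * inner ℝ G G
  set Q := ∫ x in T.body κ, β x * u.1 κ x * u.1 κ x
  have hκ0 := T.interpConst_nonneg κ
  have hκ1 : T.interpConst κ ^ 2 ≤ h ^ 2 := pow_le_pow_left₀ hκ0 (T.interpConst_le_meshSize κ) 2
  have hL0 : 0 ≤ L ^ 2 / α₀ := by positivity
  calc (a + T.interpConst κ * b) ^ 2 ≤ 2 * a ^ 2 + 2 * (T.interpConst κ ^ 2 * b ^ 2) := by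
        nlinarith [sq_nonneg (a - T.interpConst κ * b)]
    _ ≤ 2 * (h ^ 2 * (L ^ 2 / α₀ * P)) + 2 * (h ^ 2 * (B * Q)) := by gcongr
    -- The cross terms are added so that `L ^ 2 / α₀ + B` factors out of `P + Q`.
    _ ≤ 2 * (h ^ 2 * (L ^ 2 / α₀ * P)) + 2 * (h ^ 2 * (B * Q)) +
        2 * h ^ 2 * (L ^ 2 / α₀ * Q + B * P) := le_add_of_nonneg_right (by positivity)
    _ = _ := by ring

/-! ### Nodal interpolation -/

/-- The affine function on an element with the vertex values of `f`. -/
def vertexInterp (κ : T.cells) : (E d → ℝ) →ₗ[ℝ] (E d →ᵃ[ℝ] ℝ) where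
  toFun f := ∑ p : (κ : Finset (E d)), f p • (T.cellBasis κ).coord p
  map_add' f g := by simp [add_smul, Finset.sum_add_distrib]
  map_smul' c f := by simp [mul_smul, Finset.smul_sum]

theorem vertexInterp_apply (κ : T.cells) (f : E d → ℝ) (x : E d) :
    T.vertexInterp κ f x = ∑ p : (κ : Finset (E d)), f p * (T.cellBasis κ).coord p x := by
  have h : ∀ s : Finset (κ : Finset (E d)),
      (∑ p ∈ s, f p • (T.cellBasis κ).coord p) x = ∑ p ∈ s, f p * (T.cellBasis κ).coord p x := by
    intro s
    classical
    induction s using Finset.induction_on with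
    | empty => simp
    | insert a s ha ih => simp [Finset.sum_insert ha, ih]
  exact h Finset.univ

theorem vertexInterp_vertex (κ : T.cells) (f : E d → ℝ) {q : E d}
    (hq : q ∈ (κ : Finset (E d))) : T.vertexInterp κ f q = f q := by
  classical
  rw [vertexInterp_apply]
  have : ∀ p : (κ : Finset (E d)), (T.cellBasis κ).coord p q = if p = ⟨q, hq⟩ then 1 else 0 :=
    fun p => (T.cellBasis κ).coord_apply p ⟨q, hq⟩
  simp [this]

/-- The right-hand side depends on the face alone and not on the element, which is why the nodal
interpolant belongs to `crSpace`. -/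
theorem vertexInterp_centroid (κ : T.cells) (f : E d → ℝ) {e : Finset (E d)}
    (he : e ⊆ (κ : Finset (E d))) (hne : e.Nonempty) :
    T.vertexInterp κ f (e.centroid ℝ id) = ∑ q ∈ e, (e.card : ℝ)⁻¹ * f q := by
  have hw : ∑ q ∈ e, e.centroidWeights ℝ q = 1 :=
    e.sum_centroidWeights_eq_one_of_nonempty ℝ hne
  rw [Finset.centroid_def, Finset.map_affineCombination _ _ _ hw,
    Finset.affineCombination_eq_linear_combination _ _ _ hw]
  refine Finset.sum_congr rfl fun q hq => ?_
  rw [Finset.centroidWeights_apply, smul_eq_mul, Function.comp_apply, id,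
    T.vertexInterp_vertex κ f (he hq)]

/-- Values of the interpolant lie between bounds for the vertex values. -/
theorem vertexInterp_mem_of_convex (κ : T.cells) (f : E d → ℝ) {s : Set ℝ} (hs : Convex ℝ s)
    (hf : ∀ p ∈ (κ : Finset (E d)), f p ∈ s) {x : E d} (hx : x ∈ T.body κ) :
    T.vertexInterp κ f x ∈ s := by
  rw [vertexInterp_apply]
  simp only [mul_comm (f _)]
  rw [T.body_eq] at hx
  exact hs.sum_mem (fun p _ => hx p) ((T.cellBasis κ).sum_coord_apply_eq_one x)
    (fun p _ => hf p p.2)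

theorem abs_vertexInterp_le (κ : T.cells) {f : E d → ℝ} {B : ℝ} (hf : ∀ x, |f x| ≤ B) {x : E d}
    (hx : x ∈ T.body κ) : |T.vertexInterp κ f x| ≤ B :=
  abs_le.2 (T.vertexInterp_mem_of_convex κ f (convex_Icc (-B) B) (fun p _ => abs_le.1 (hf p)) hx)

theorem abs_vertexInterp_sub_le (κ : T.cells) {f : E d → ℝ} {L : ℝ} (hL : 0 ≤ L)
    (hf : ∀ x y, |f x - f y| ≤ L * dist x y) {x y : E d} (hx : x ∈ T.body κ)
    (hy : y ∈ T.body κ) : |T.vertexInterp κ f x - f y| ≤ L * T.cellDiam κ := by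
  have h := T.vertexInterp_mem_of_convex κ f (s := Set.Icc (f y - L * T.cellDiam κ)
    (f y + L * T.cellDiam κ)) (convex_Icc _ _) (fun p hp => ?_) hx
  · rw [abs_le]
    constructor <;> linarith [h.1, h.2]
  · have h1 := (hf p y).trans (mul_le_mul_of_nonneg_left
      (T.dist_le_cellDiam κ (T.subset_body κ hp) hy) hL)
    rw [abs_le] at h1
    constructor <;> linarith [h1.1, h1.2]

/-- The interpolant rises by at most `2 L h_κ` above its value at the center of a ball of radius
`h_κ / σ` inside the element, and `h_κ` cancels. It is here that shape regularity enters. -/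
theorem norm_affGrad_vertexInterp_le (hd : 0 < d) {σ : ℝ} (hσ : 0 < σ) (hT : T.ShapeRegular σ)
    (κ : T.cells) {f : E d → ℝ} {L : ℝ} (hL : 0 ≤ L)
    (hf : ∀ x y, |f x - f y| ≤ L * dist x y) :
    ‖affGrad (T.vertexInterp κ f)‖ ≤ 2 * L * σ := by
  obtain ⟨x, hx⟩ := hT κ
  have hh := T.cellDiam_pos hd κ
  have hr : 0 < T.cellDiam κ / σ := div_pos hh hσ
  have hxb : x ∈ T.body κ := hx (Metric.mem_closedBall_self hr.le)
  have key := norm_affGrad_mul_le (T.vertexInterp κ f) (w := 2 * L * T.cellDiam κ) hr.le hx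
    (by positivity) (fun y hy => by
      have h1 := abs_le.1 (T.abs_vertexInterp_sub_le κ hL hf hy hxb)
      have h2 := abs_le.1 (T.abs_vertexInterp_sub_le κ hL hf hxb hxb)
      linarith [h1.2, h2.1])
  rw [← mul_div_assoc, div_le_iff₀ hσ] at key
  have : ‖affGrad (T.vertexInterp κ f)‖ * T.cellDiam κ ≤ 2 * L * σ * T.cellDiam κ := by linarith
  exact le_of_mul_le_mul_right this hh

/-- The piecewise affine nodal interpolation operator into the Crouzeix–Raviart space. -/
def nodalInterp (hd : 0 < d) : (E d → ℝ) →ₗ[ℝ] T.crSpace :=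
  (LinearMap.pi T.vertexInterp).codRestrict T.crSpace fun f κ κ' e he he' hcard => by
    have hne : e.Nonempty := Finset.card_pos.1 (by omega)
    simp only [LinearMap.pi_apply]
    rw [T.vertexInterp_centroid κ f he hne, T.vertexInterp_centroid κ' f he' hne]

@[simp]
theorem nodalInterp_coe (hd : 0 < d) (f : E d → ℝ) (κ : T.cells) :
    (T.nodalInterp hd f).1 κ = T.vertexInterp κ f := rfl

/-- Interpolants of Lipschitz functions have bounded energy on regular meshes. -/
theorem aForm_nodalInterp_le (hd : 0 < d) (hΩ : interior (closure Ω) = Ω)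
    (hΩv : volume Ω ≠ ⊤) {σ : ℝ} (hσ : 0 < σ)
    (hT : T.ShapeRegular σ) {A B : ℝ} (hA0 : 0 ≤ A) (hB0 : 0 ≤ B)
    (hA : ∀ κ : T.cells, ∀ᵐ x ∂(volume.restrict (T.body κ)), α x ≤ A)
    (hB : ∀ κ : T.cells, ∀ᵐ x ∂(volume.restrict (T.body κ)), β x ≤ B) {f : E d → ℝ} {L N : ℝ}
    (hL : 0 ≤ L) (hf : ∀ x y, |f x - f y| ≤ L * dist x y) (hN : ∀ x, |f x| ≤ N) :
    T.aForm α β (T.nodalInterp hd f) (T.nodalInterp hd f) ≤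
      (A * (2 * L * σ) ^ 2 + B * N ^ 2) * (volume Ω).toReal := by
  have hK : 0 ≤ A * (2 * L * σ) ^ 2 + B * N ^ 2 := by positivity
  have hcell : ∀ κ : T.cells, ∫ x in T.body κ,
      (α x * inner ℝ (gradient ((T.nodalInterp hd f).1 κ) x)
        (gradient ((T.nodalInterp hd f).1 κ) x) +
        β x * (T.nodalInterp hd f).1 κ x * (T.nodalInterp hd f).1 κ x) ≤
      (A * (2 * L * σ) ^ 2 + B * N ^ 2) * (volume (T.body κ)).toReal := by
    intro κ
    simp only [gradient_affineMap, nodalInterp_coe]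
    set v := T.vertexInterp κ f
    -- Only upper bounds for `α` and `β` are available here; without integrability the integral is
    -- `0` by convention and the bound is trivial.
    by_cases hint : IntegrableOn (fun x => α x * inner ℝ (affGrad v) (affGrad v) +
        β x * v x * v x) (T.body κ)
    · have hconst : ∫ _ in T.body κ, (A * (2 * L * σ) ^ 2 + B * N ^ 2) =
          (A * (2 * L * σ) ^ 2 + B * N ^ 2) * (volume (T.body κ)).toReal := by
        rw [setIntegral_const, smul_eq_mul, mul_comm]
        rfl
      rw [← hconst]
      refine integral_mono_ae hint (integrable_const _) ?_
      filter_upwards [hA κ, hB κ, ae_restrict_mem (T.measurableSet_body κ)] with x hAx hBx hx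
      have h1 : ‖affGrad v‖ ^ 2 ≤ (2 * L * σ) ^ 2 := pow_le_pow_left₀ (norm_nonneg _)
        (T.norm_affGrad_vertexInterp_le hd hσ hT κ hL hf) 2
      have h2 : v x * v x ≤ N ^ 2 := by
        rw [← sq, ← sq_abs]
        exact pow_le_pow_left₀ (abs_nonneg _) (T.abs_vertexInterp_le κ hN hx) 2
      have h3 : 0 ≤ v x * v x := mul_self_nonneg _
      rw [real_inner_self_eq_norm_sq, mul_assoc (β x)]
      gcongr
    · rw [integral_undef hint]
      positivity
  refine (Finset.sum_le_sum fun κ _ => hcell κ).trans ?_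
  rw [← Finset.mul_sum]
  refine mul_le_mul_of_nonneg_left ?_ hK
  rw [← ENNReal.toReal_sum fun κ _ => ((T.isCompact_body κ).measure_lt_top (μ := volume)).ne]
  exact ENNReal.toReal_mono hΩv (T.sum_volume_body_le hΩ)

end Mesh

/-! ### The min-max principle -/

/-- The largest eigenvalue of a symmetric form on a finite-dimensional inner product space bounds
the form. -/
theorem exists_eigenvector_form_le {W : Type*} [NormedAddCommGroup W] [InnerProductSpace ℝ W]
    [FiniteDimensional ℝ W] [Nontrivial W] (b : W →ₗ[ℝ] W →ₗ[ℝ] ℝ)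
    (hb : ∀ x y, b x y = b y x) :
    ∃ (m : ℝ) (w : W), w ≠ 0 ∧ (∀ y, b w y = m * inner ℝ w y) ∧
      ∀ v, b v v ≤ m * inner ℝ v v := by
  -- The Riesz representative of `b`; the supremum of its Rayleigh quotient is an eigenvalue.
  let S : W →ₗ[ℝ] W := LinearMap.comp
    (InnerProductSpace.toDual ℝ W).symm.toLinearEquiv.toLinearMap
    (LinearMap.comp (LinearMap.toContinuousLinearMap (𝕜 := ℝ) (E := W) (F' := ℝ)).toLinearMap b)
  have hS : ∀ x y, inner ℝ (S x) y = b x y := by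
    intro x y
    simp [S, InnerProductSpace.toDual_symm_apply]
  have hsym : S.IsSymmetric := fun x y => by
    rw [hS, real_inner_comm, hS, hb]
  obtain ⟨w, hw⟩ := hsym.hasEigenvalue_iSup_of_finiteDimensional.exists_hasEigenvector
  refine ⟨⨆ x : {x : W // x ≠ 0}, RCLike.re (inner ℝ (S x) (x : W)) / ‖(x : W)‖ ^ 2, w, hw.2,
    fun y => ?_, fun v => ?_⟩
  rotate_left
  · by_cases hv : v = 0
    · simp [hv]
    have hvn : 0 < ‖v‖ := norm_pos_iff.2 hv
    have hbdd : BddAbove (Set.range fun x : {x : W // x ≠ 0} =>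
        RCLike.re (inner ℝ (S x) (x : W)) / ‖(x : W)‖ ^ 2) := by
      refine ⟨‖S.toContinuousLinearMap‖, ?_⟩
      rintro _ ⟨x, rfl⟩
      have hxn : 0 < ‖(x : W)‖ := norm_pos_iff.2 x.2
      rw [div_le_iff₀ (by positivity)]
      calc _ ≤ ‖S x‖ * ‖(x : W)‖ := real_inner_le_norm _ _
        _ ≤ (‖S.toContinuousLinearMap‖ * ‖(x : W)‖) * ‖(x : W)‖ :=
            mul_le_mul_of_nonneg_right (S.toContinuousLinearMap.le_opNorm x) (norm_nonneg _)
        _ = _ := by ring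
    have := le_ciSup hbdd ⟨v, hv⟩
    rw [div_le_iff₀ (by positivity)] at this
    rw [real_inner_self_eq_norm_sq, ← hS]
    exact this
  · rw [← hS, hw.apply_eq_smul, real_inner_smul_left]
    rfl

/-- A positive definite form and a symmetric form on a finite-dimensional space have an eigenpair
whose eigenvalue is a bound for the Rayleigh quotient. -/
theorem exists_generalized_eigenvector {W : Type*} [AddCommGroup W] [Module ℝ W]
    [FiniteDimensional ℝ W] [Nontrivial W] (a b : W →ₗ[ℝ] W →ₗ[ℝ] ℝ)
    (ha : ∀ x y, a x y = a y x) (hapos : ∀ x, x ≠ 0 → 0 < a x x) (hb : ∀ x y, b x y = b y x) :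
    ∃ (m : ℝ) (w : W), w ≠ 0 ∧ (∀ y, b w y = m * a w y) ∧ ∀ v, b v v ≤ m * a v v := by
  -- The inner product is `a`, because `b` may degenerate. The values `m` are thus reciprocals of
  -- Steklov eigenvalues, and the largest `m` gives the smallest eigenvalue.
  let core : InnerProductSpace.Core ℝ W :=
    { inner := fun x y => a x y
      conj_inner_symm := fun x y => ha y x
      re_inner_nonneg := fun x => by
        by_cases h : x = 0
        · simp [h]
        · exact (hapos x h).le
      add_left := fun x y z => by simp
      smul_left := fun x y r => by simp
      definite := fun x hx => by
        by_contra h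
        exact (hapos x h).ne' hx }
  let : NormedAddCommGroup W := core.toNormedAddCommGroup
  let : InnerProductSpace ℝ W := InnerProductSpace.ofCore core.toCore
  exact exists_eigenvector_form_le b hb

/-- The `j`-th eigenvalue is bounded by the Rayleigh quotient on every `j`-dimensional space. -/
theorem IsJthEigenpair.exists_rayleigh {V : Type*} [AddCommGroup V] [Module ℝ V]
    [FiniteDimensional ℝ V] {a b : V →ₗ[ℝ] V →ₗ[ℝ] ℝ}
    (ha : ∀ x y, a x y = a y x) (hapos : ∀ x, x ≠ 0 → 0 < a x x) (hb : ∀ x y, b x y = b y x)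
    {j : ℕ} (hj : 1 ≤ j) {lam : ℝ} {u : V}
    (h : IsJthEigenpair (fun x y => a x y) (fun x y => b x y) j lam u)
    (f : (Fin j → ℝ) →ₗ[ℝ] V) (hf : ∀ c, c ≠ 0 → 0 < b (f c) (f c)) :
    ∃ c, c ≠ 0 ∧ lam * b (f c) (f c) ≤ a (f c) (f c) := by
  obtain ⟨-, μ, w, hw, horth, hmin⟩ := h
  simp only [IsEigenpair] at hw horth hmin
  let K : V →ₗ[ℝ] (Fin (j - 1) → ℝ) := LinearMap.pi fun i => b (w i)
  -- Orthogonality to the `j - 1` earlier eigenfunctions imposes `j - 1` conditions on `j`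
  -- coefficients.
  obtain ⟨c, hc, hc0⟩ := (Submodule.ne_bot_iff _).1
    (LinearMap.ker_ne_bot_of_finrank_lt (f := K.comp f) (by simp; omega))
  refine ⟨c, hc0, ?_⟩
  have hbc := hf c hc0
  have hfK : f c ∈ LinearMap.ker K := hc
  let W := LinearMap.ker K
  have hWmem : ∀ x : W, ∀ i, b (w i) x = 0 := fun x i => congrFun x.2 i
  have : Nontrivial W := by
    refine ⟨⟨f c, hfK⟩, 0, fun h0 => ?_⟩
    have : f c = 0 := congrArg Subtype.val h0
    simp [this] at hbc
  obtain ⟨m, x, hx0, hx, hm⟩ := exists_generalized_eigenvector (a.domRestrict₁₂ W W)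
    (b.domRestrict₁₂ W W) (fun x y => ha x y)
    (fun x hx => hapos x fun h0 => hx (Subtype.ext h0)) (fun x y => hb x y)
  simp only [LinearMap.domRestrict₁₂_apply] at hx hm
  have hapc : 0 < a (f c) (f c) := hapos _ fun h0 => by simp [h0] at hbc
  have hmc := hm ⟨f c, hfK⟩
  have hm0 : 0 < m := by
    by_contra hneg
    exact absurd (hbc.trans_le hmc) (not_lt.2 (mul_nonpos_of_nonpos_of_nonneg
      (not_lt.1 hneg) hapc.le))
  have hax : 0 < a x x := hapos x fun h0 => hx0 (Subtype.ext h0)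
  have hbx : 0 < b x x := by
    rw [hx x]; positivity
  -- So far `x` solves the eigenvalue equation only against `W`. It extends to all test vectors by
  -- subtracting their components along the `w i`, since `a x (w i) = μ i * b (w i) x = 0`.
  have hdual : ∀ v, a x v = m⁻¹ * b x v := by
    intro v
    have hproj : v - ∑ i, b (w i) v • w i ∈ W := by
      refine LinearMap.mem_ker.2 (funext fun k => ?_)
      simp only [K, LinearMap.pi_apply, map_sub, map_sum, map_smul, smul_eq_mul, Pi.zero_apply]
      rw [Finset.sum_eq_single k (fun i _ hik => by rw [horth k i hik.symm, mul_zero])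
        (fun h => absurd (Finset.mem_univ k) h)]
      rw [(hw k).1.1, mul_one, sub_self]
    have h1 := hx ⟨_, hproj⟩
    have h2 : ∀ i, b x (w i) = 0 := fun i => by rw [hb]; exact hWmem x i
    have h3 : ∀ i, a x (w i) = 0 := fun i => by
      rw [ha, (hw i).1.2, hWmem x i, mul_zero]
    simp only [map_sub, map_sum, map_smul, h2, h3, smul_zero, Finset.sum_const_zero,
      sub_zero] at h1
    rw [h1, inv_mul_cancel_left₀ hm0.ne']
  -- Normalized, `x` becomes an eigenpair orthogonal to the `w i`, so minimality gives `lam ≤ m⁻¹`.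
  set r := (Real.sqrt (b x x))⁻¹ with hr
  have hrr : r * (r * b x x) = 1 := by
    rw [← mul_assoc, hr, ← mul_inv, Real.mul_self_sqrt hbx.le, inv_mul_cancel₀ hbx.ne']
  have hle := hmin m⁻¹ (r • (x : V)) ⟨by simpa using hrr, fun v => by
    simp only [map_smul, LinearMap.smul_apply, smul_eq_mul, hdual v]; ring⟩
    (fun i => by simp [hWmem x i])
  calc lam * b (f c) (f c) ≤ m⁻¹ * b (f c) (f c) := mul_le_mul_of_nonneg_right hle hbc.le
    _ ≤ m⁻¹ * (m * a (f c) (f c)) := mul_le_mul_of_nonneg_left hmc (inv_pos.2 hm0).le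
    _ = _ := inv_mul_cancel_left₀ hm0.ne' _

/-! ### Trial functions concentrated on parts of the boundary -/

/-- The orthogonal projection forgetting the last coordinate. -/
def dropLast {n : ℕ} (x : E (n + 1)) : E n := WithLp.toLp 2 fun i => x i.castSucc

theorem lipschitzWith_dropLast {n : ℕ} : LipschitzWith 1 (dropLast : E (n + 1) → E n) := by
  refine LipschitzWith.of_dist_le_mul fun x y => ?_
  rw [NNReal.coe_one, one_mul, EuclideanSpace.dist_eq, EuclideanSpace.dist_eq]
  refine Real.sqrt_le_sqrt ?_
  rw [Fin.sum_univ_castSucc]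
  exact le_add_of_nonneg_right (sq_nonneg _)

/-- Every slab in the direction of the first coordinate that meets a bounded open set contains a
part of its boundary of positive surface measure. -/
theorem surfaceMeasure_slab_pos {n : ℕ} {Ω : Set (E (n + 1))} (ho : IsOpen Ω)
    (hb : Bornology.IsBounded Ω) (i : Fin n) {t ε : ℝ} {z : E (n + 1)} (hz : z ∈ Ω)
    (hzt : |z i.castSucc - t| < ε) :
    0 < surfaceMeasure Ω {x | |x i.castSucc - t| < ε} := by
  have hSo : IsOpen {x : E (n + 1) | |x i.castSucc - t| < ε} :=
    isOpen_lt (by fun_prop) continuous_const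
  set S := {x : E (n + 1) | |x i.castSucc - t| < ε}
  rw [surfaceMeasure, Measure.restrict_apply hSo.measurableSet]
  let Q : ℝ → E n → E (n + 1) := fun s y => WithLp.toLp 2 (Fin.snoc (α := fun _ => ℝ) y s)
  have hQ : Continuous fun p : ℝ × E n => Q p.1 p.2 := by
    refine (PiLp.continuous_toLp 2 _).comp (continuous_pi fun k => ?_)
    induction k using Fin.lastCases with
    | last => simpa using continuous_fst
    | cast k => simp only [Fin.snoc_castSucc]; fun_prop
  have hQc : ∀ s y, Q s y i.castSucc = y i := fun s y => by simp [Q]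
  have hQl : ∀ s y, Q s y (Fin.last n) = s := fun s y => by simp [Q]
  have hQd : ∀ s y, dropLast (Q s y) = y := fun s y => by
    ext k
    simp [Q, dropLast]
  -- The slice of `Ω ∩ S` at the height of `z`, an open nonempty subset of `ℝⁿ`.
  let V : Set (E n) := Q (z (Fin.last n)) ⁻¹' (Ω ∩ S)
  have hVo : IsOpen V := (ho.inter hSo).preimage (hQ.comp (by fun_prop : Continuous
    fun y : E n => (z (Fin.last n), y)))
  have hVne : V.Nonempty := by
    refine ⟨dropLast z, ?_⟩
    have : Q (z (Fin.last n)) (dropLast z) = z := by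
      ext k
      induction k using Fin.lastCases with
      | last => simp [Q]
      | cast k => simp [Q, dropLast]
    change Q (z (Fin.last n)) (dropLast z) ∈ Ω ∩ S
    rw [this]
    exact ⟨hz, hzt⟩
  -- The line over `y` in the last direction meets `Ω` but leaves it by boundedness, hence hits the
  -- boundary; it stays in the slab because the slab constrains a different coordinate. The
  -- projection is 1-Lipschitz, so its shadow bounds the boundary measure from below.
  have hV : V ⊆ dropLast '' (S ∩ frontier Ω) := by
    intro y hy
    have hline : Continuous fun s => Q s y :=
      hQ.comp (by fun_prop : Continuous fun s : ℝ => (s, y))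
    obtain ⟨R, hR⟩ := hb.exists_norm_le
    have hout : Q (R + 1) y ∉ Ω := fun hmem => by
      have h1 := hR _ hmem
      have h2 := PiLp.norm_apply_le (Q (R + 1) y) (Fin.last n)
      rw [hQl, Real.norm_eq_abs] at h2
      linarith [le_abs_self (R + 1)]
    obtain ⟨s, hs⟩ := nonempty_frontier_iff (s := (fun s => Q s y) ⁻¹' Ω) |>.2
      ⟨⟨z (Fin.last n), hy.1⟩, fun h => hout (h.symm.subset (Set.mem_univ (R + 1)))⟩
    have hx : Q s y ∈ frontier Ω := hline.frontier_preimage_subset Ω hs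
    refine ⟨Q s y, ⟨?_, hx⟩, hQd s y⟩
    have h3 := hy.2
    simp only [S, Set.mem_ofPred_eq, hQc] at h3 ⊢
    exact h3
  have hpos : 0 < volume V := hVo.measure_pos volume hVne
  have h4 := (measure_mono hV).trans
    (euclideanHausdorffMeasure_image_le lipschitzWith_dropLast n (S ∩ frontier Ω))
  rw [← EuclideanSpace.euclideanHausdorffMeasure_eq_volume] at hpos
  simpa using hpos.trans_le h4

/-- Lipschitz functions that separate parts of the boundary of positive measure. -/
theorem exists_separating_functions (hd : 2 ≤ d) {Ω : Set (E d)} (ho : IsOpen Ω)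
    (hb : Bornology.IsBounded Ω) (hne : Ω.Nonempty) (j : ℕ) :
    ∃ (f : Fin j → E d → ℝ) (S : Fin j → Set (E d)) (L : ℝ), 0 ≤ L ∧
      (∀ i x y, |f i x - f i y| ≤ L * dist x y) ∧ (∀ i x, |f i x| ≤ 1) ∧
      (∀ i, MeasurableSet (S i)) ∧ (∀ i, 0 < surfaceMeasure Ω (S i)) ∧
      (∀ i, ∀ x ∈ S i, 3 / 4 ≤ f i x) ∧ ∀ i k, k ≠ i → ∀ x ∈ S i, f k x = 0 := by
  obtain ⟨n, rfl⟩ : ∃ n, d = n + 2 := ⟨d - 2, by omega⟩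
  obtain ⟨x₀, hx₀⟩ := hne
  obtain ⟨r, hr, hrΩ⟩ := Metric.isOpen_iff.1 ho x₀ hx₀
  -- The first coordinate differs from the last one, the direction of projection, because `d ≥ 2`.
  let o : Fin (n + 2) := (0 : Fin (n + 1)).castSucc
  -- With `2 ρ (j + 1) = r`, the `j` points at spacing `2 ρ` from `x₀` stay in the ball inside `Ω`.
  let ρ : ℝ := r / (2 * ((j : ℝ) + 1))
  have hρ : 0 < ρ := by positivity
  let t : Fin j → ℝ := fun i => x₀ o + 2 * ρ * i
  have hcoord : ∀ x y : E (n + 2), |x o - y o| ≤ dist x y := fun x y => by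
    have := PiLp.norm_apply_le (x - y) o
    rwa [← dist_eq_norm, Real.norm_eq_abs] at this
  have hsep : ∀ i k : Fin j, k ≠ i → 2 * ρ ≤ |t i - t k| := by
    intro i k hik
    have h1 : (1 : ℝ) ≤ |(i : ℝ) - k| := by
      have : (1 : ℤ) ≤ |(i : ℤ) - k| := Int.one_le_abs (by
        have := Fin.val_ne_of_ne hik
        omega)
      exact_mod_cast this
    have h2 : t i - t k = 2 * ρ * ((i : ℝ) - k) := by simp only [t]; ring
    rw [h2, abs_mul, abs_of_pos (by positivity : (0 : ℝ) < 2 * ρ)]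
    nlinarith
  -- Hats of half-width `ρ` are at least `3 / 4` within `ρ / 4` of their center, and vanish on the
  -- other slabs, at distance at least `2 ρ - ρ / 4` from it.
  refine ⟨fun i x => max 0 (1 - |x o - t i| / ρ), fun i => {x | |x o - t i| < ρ / 4}, 1 / ρ,
    by positivity, fun i x y => ?_, fun i x => ?_, fun i => ?_, fun i => ?_, fun i x hx => ?_,
    fun i k hik x hx => ?_⟩
  · simp only [max_comm (0 : ℝ)]
    refine (abs_max_sub_max_le_abs _ _ _).trans ?_
    have h1 : 1 - |x o - t i| / ρ - (1 - |y o - t i| / ρ) = (|y o - t i| - |x o - t i|) / ρ := by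
      ring
    rw [h1, abs_div, abs_of_pos hρ, div_eq_inv_mul, one_div]
    refine mul_le_mul_of_nonneg_left ?_ (by positivity)
    refine (abs_abs_sub_abs_le _ _).trans ?_
    rw [sub_sub_sub_cancel_right, abs_sub_comm]
    exact hcoord x y
  · rw [abs_of_nonneg (le_max_left _ _)]
    exact max_le zero_le_one (sub_le_self _ (by positivity))
  · exact (isOpen_lt (by fun_prop) continuous_const).measurableSet
  · refine surfaceMeasure_slab_pos ho hb (0 : Fin (n + 1))
      (z := x₀ + EuclideanSpace.single o (2 * ρ * i)) (hrΩ ?_) ?_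
    · rw [Metric.mem_ball, dist_eq_norm, add_sub_cancel_left, PiLp.norm_single,
        Real.norm_of_nonneg (by positivity)]
      have h1 : (i : ℝ) < (j : ℝ) + 1 := by
        have : (i : ℝ) < j := by exact_mod_cast i.2
        linarith
      calc 2 * ρ * i < 2 * ρ * ((j : ℝ) + 1) := by gcongr
        _ = r := by simp only [ρ]; field_simp
    · have : (x₀ + EuclideanSpace.single o (2 * ρ * i)) (0 : Fin (n + 1)).castSucc - t i = 0 := by
        change (x₀ + EuclideanSpace.single o (2 * ρ * i)) o - t i = 0
        simp [t]
      rw [this, abs_zero]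
      positivity
  · refine le_max_of_le_right ?_
    have : |x o - t i| / ρ ≤ 1 / 4 := by
      rw [div_le_iff₀ hρ]
      linarith [show |x o - t i| < ρ / 4 from hx]
    linarith
  · refine max_eq_left ?_
    have h1 := hsep i k hik
    have h2 : |x o - t i| < ρ / 4 := hx
    have h3 : |t i - t k| ≤ |x o - t i| + |x o - t k| := by
      have := abs_sub_le (t i) (x o) (t k)
      rwa [abs_sub_comm (t i) (x o)] at this
    have : 1 ≤ |x o - t k| / ρ := by
      rw [le_div_iff₀ hρ]
      linarith
    linarith

namespace Mesh

variable {Ω : Set (E d)} (T : Mesh Ω) {α β : E d → ℝ}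

/-- The elements cover `∂Ω`, so splitting the boundary among them loses no measure, and overlaps
only increase the sum. -/
theorem le_bForm [IsFiniteMeasure (surfaceMeasure Ω)] {S : Set (E d)} (hS : MeasurableSet S)
    {r : ℝ} (u : T.crSpace) (hu : ∀ κ, ∀ x ∈ T.body κ ∩ S, r ≤ u.1 κ x * u.1 κ x) (hr : 0 ≤ r) :
    r * (surfaceMeasure Ω).real S ≤ T.bForm u u := by
  have hcover : (surfaceMeasure Ω).real S ≤
      ∑ κ : T.cells, (surfaceMeasure Ω).real (T.body κ ∩ S) := by
    have h1 : (surfaceMeasure Ω) S ≤ (surfaceMeasure Ω) (⋃ κ : T.cells, T.body κ ∩ S) := by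
      rw [surfaceMeasure, Measure.restrict_apply hS]
      refine (measure_mono ?_).trans (Measure.le_restrict_apply _ _)
      rintro x ⟨hx, hxf⟩
      refine ⟨?_, hxf⟩
      have h2 := frontier_subset_closure hxf
      rw [T.closure_eq_iUnion_body] at h2
      obtain ⟨κ, hκ⟩ := Set.mem_iUnion.1 h2
      exact Set.mem_iUnion.2 ⟨κ, hκ, hx⟩
    exact (ENNReal.toReal_mono (measure_ne_top _ _) h1).trans (measureReal_iUnion_fintype_le _)
  refine (mul_le_mul_of_nonneg_left hcover hr).trans ?_
  rw [Finset.mul_sum]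
  refine Finset.sum_le_sum fun κ _ => ?_
  have hint := T.integrableOn_body_surface κ (continuous_affineMap_mul (u.1 κ) (u.1 κ))
  have hmeas := (T.measurableSet_body κ).inter hS
  calc r * (surfaceMeasure Ω).real (T.body κ ∩ S)
      = ∫ _ in T.body κ ∩ S, r ∂(surfaceMeasure Ω) := by
        rw [setIntegral_const, smul_eq_mul, mul_comm]
    _ ≤ ∫ x in T.body κ ∩ S, u.1 κ x * u.1 κ x ∂(surfaceMeasure Ω) :=
        setIntegral_mono_on (integrable_const _) (hint.mono_set Set.inter_subset_left) hmeas
          (hu κ)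
    _ ≤ _ := setIntegral_mono_set hint (Eventually.of_forall fun x => mul_self_nonneg _)
        (Eventually.of_forall Set.inter_subset_left)

end Mesh

/-! ### Uniform bound of the discrete eigenvalues -/

/-- The `j`-th discrete eigenvalues are bounded on fine regular meshes. -/
theorem exists_bound_jth_eigenvalue (hd : 2 ≤ d) {Ω : Set (E d)} (ho : IsOpen Ω)
    (hbd : Bornology.IsBounded Ω) (hne : Ω.Nonempty) (hΩ : interior (closure Ω) = Ω)
    [IsFiniteMeasure (surfaceMeasure Ω)] {α β : E d → ℝ} {α₀ β₀ A B : ℝ}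
    (hα : MemLp α ∞ (volume.restrict Ω)) (hα₀ : 0 < α₀)
    (hαlow : ∀ᵐ x ∂(volume.restrict Ω), α₀ ≤ α x)
    (hβ : MemLp β ∞ (volume.restrict Ω)) (hβ₀ : 0 < β₀)
    (hβlow : ∀ᵐ x ∂(volume.restrict Ω), β₀ ≤ β x)
    (hA : ∀ᵐ x ∂(volume.restrict Ω), α x ≤ A) (hA0 : 0 ≤ A)
    (hB : ∀ᵐ x ∂(volume.restrict Ω), β x ≤ B) (hB0 : 0 ≤ B)
    {σ : ℝ} (hσ : 0 < σ) {j : ℕ} (hj : 1 ≤ j) :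
    ∃ Λ h₀ : ℝ, 0 < h₀ ∧ ∀ (T : Mesh Ω), T.ShapeRegular σ → T.meshSize ≤ h₀ →
      ∀ (lamh : ℝ) (uh : T.crSpace), IsJthEigenpair (T.aForm α β) T.bForm j lamh uh →
        lamh ≤ Λ := by
  have hd0 : 0 < d := by omega
  have : NeZero j := ⟨by omega⟩
  obtain ⟨f, S, L, hL, hfL, hf1, hSm, hSpos, hf34, hf0⟩ :=
    exists_separating_functions hd ho hbd hne j
  obtain ⟨i₁, -, hi₁⟩ := Finset.univ.exists_min_image
    (fun i => (surfaceMeasure Ω).real (S i)) ⟨(0 : Fin j), Finset.mem_univ _⟩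
  set m := (surfaceMeasure Ω).real (S i₁)
  have hm : 0 < m := ENNReal.toReal_pos (hSpos i₁).ne' (measure_ne_top _ _)
  let N : ℝ := j
  have hN : 0 < N := by simp only [N]; exact_mod_cast hj
  let K : ℝ := (A * (2 * (N * L) * σ) ^ 2 + B * N ^ 2) * (volume Ω).toReal
  -- The bound is the quotient of `a ≤ K r` and `b ≥ r m / 4`. The mesh threshold keeps the
  -- interpolation error below a quarter of the largest coefficient; the `+ 1` covers `L = 0`.
  refine ⟨4 * K / m, 1 / (4 * (N * L + 1)), by positivity, fun T hT hh lamh uh hpair => ?_⟩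
  have hle := T.restrict_body_le hΩ
  have hac : ∀ {p : E d → Prop}, (∀ᵐ x ∂(volume.restrict Ω), p x) → ∀ κ : T.cells,
      ∀ᵐ x ∂(volume.restrict (T.body κ)), p x := fun hp κ => ae_mono (hle κ) hp
  have hα' := fun κ => hα.mono_measure (hle κ)
  have hβ' := fun κ => hβ.mono_measure (hle κ)
  have hNLh : N * L * T.meshSize ≤ 1 / 4 := by
    have h1 : N * L * T.meshSize ≤ N * L * (1 / (4 * (N * L + 1))) :=
      mul_le_mul_of_nonneg_left hh (by positivity)
    refine h1.trans ?_
    rw [mul_one_div, div_le_div_iff₀ (by positivity) (by norm_num)]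
    nlinarith [mul_nonneg hN.le hL]
  let F : (Fin j → ℝ) →ₗ[ℝ] (E d → ℝ) := Fintype.linearCombination ℝ f
  have hF : ∀ c x, F c x = ∑ k, c k * f k x := fun c x => by
    simp [F, Fintype.linearCombination_apply]
  let G : (Fin j → ℝ) →ₗ[ℝ] T.crSpace := (T.nodalInterp hd0).comp F
  -- Here `r` is the square of the largest `|c i|`. The lower bound also shows that the interpolants
  -- remain linearly independent.
  have hbounds : ∀ c : Fin j → ℝ, c ≠ 0 → ∃ r : ℝ, 0 < r ∧ r * m / 4 ≤ T.bForm (G c) (G c) ∧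
      T.aForm α β (G c) (G c) ≤ K * r := by
    intro c hc
    obtain ⟨i, -, hi⟩ := Finset.univ.exists_max_image (fun i => |c i|)
      ⟨(0 : Fin j), Finset.mem_univ _⟩
    set M := |c i| with hM
    have hM0 : 0 < M := by
      obtain ⟨k, hk⟩ := Function.ne_iff.1 hc
      exact (abs_pos.2 hk).trans_le (hi k (Finset.mem_univ k))
    have hsum : ∀ (g : Fin j → ℝ) (R : ℝ), (∀ k, |g k| ≤ R) → |∑ k, c k * g k| ≤ N * R * M := by
      intro g R hg
      refine (Finset.abs_sum_le_sum_abs _ _).trans ?_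
      refine (Finset.sum_le_sum (g := fun _ => M * R) fun k hk => ?_).trans ?_
      · rw [abs_mul]
        exact mul_le_mul (hi k hk) (hg k) (abs_nonneg _) hM0.le
      · simp only [Finset.sum_const, Finset.card_univ, Fintype.card_fin, nsmul_eq_mul, N]
        exact le_of_eq (by ring)
    have hFL : ∀ x y, |F c x - F c y| ≤ N * L * M * dist x y := by
      intro x y
      rw [hF, hF, ← Finset.sum_sub_distrib]
      simp only [← mul_sub]
      refine (hsum (fun k => f k x - f k y) _ fun k => hfL k x y).trans (le_of_eq (by ring))
    have hFN : ∀ x, |F c x| ≤ N * M := by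
      intro x
      rw [hF]
      exact (hsum (fun k => f k x) _ fun k => hf1 k x).trans (le_of_eq (by ring))
    refine ⟨M ^ 2, by positivity, ?_, ?_⟩
    -- On the slab of the largest coefficient only one hat is nonzero, so `|F c| ≥ 3 M / 4`; an
    -- interpolation error of at most `M / 4` leaves `M / 2`.
    · have hlow : ∀ κ, ∀ x ∈ T.body κ ∩ S i, M ^ 2 / 4 ≤ (G c).1 κ x * (G c).1 κ x := by
        rintro κ x ⟨hx, hxS⟩
        change _ ≤ T.vertexInterp κ (F c) x * T.vertexInterp κ (F c) x
        have h1 := T.abs_vertexInterp_sub_le κ (by positivity) hFL hx hx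
        have h2 : N * L * M * T.cellDiam κ ≤ M / 4 := by
          calc N * L * M * T.cellDiam κ ≤ N * L * M * T.meshSize :=
                mul_le_mul_of_nonneg_left (T.cellDiam_le_meshSize κ) (by positivity)
            _ = N * L * T.meshSize * M := by ring
            _ ≤ 1 / 4 * M := mul_le_mul_of_nonneg_right hNLh hM0.le
            _ = M / 4 := by ring
        have h3 : F c x = c i * f i x := by
          rw [hF]
          refine Finset.sum_eq_single i (fun k _ hk => by rw [hf0 i k hk x hxS, mul_zero])
            (fun h => absurd (Finset.mem_univ i) h)
        have h4 : 3 / 4 * M ≤ |F c x| := by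
          rw [h3, abs_mul, abs_of_nonneg (le_trans (by norm_num) (hf34 i x hxS)), ← hM]
          nlinarith [hf34 i x hxS]
        have h5 : M / 2 ≤ |T.vertexInterp κ (F c) x| := by
          have := abs_sub_abs_le_abs_sub (F c x) (T.vertexInterp κ (F c) x)
          rw [abs_sub_comm] at this
          linarith
        rw [← abs_mul_abs_self]
        nlinarith
      have h6 := T.le_bForm (hSm i) (G c) hlow (by positivity)
      refine le_trans ?_ h6
      have := hi₁ i (Finset.mem_univ i)
      calc M ^ 2 * m / 4 = M ^ 2 / 4 * m := by ring
        _ ≤ _ := mul_le_mul_of_nonneg_left this (by positivity)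
    · refine (T.aForm_nodalInterp_le hd0 hΩ hbd.measure_lt_top.ne hσ hT hA0 hB0 (hac hA)
        (hac hB) (by positivity) hFL hFN).trans (le_of_eq ?_)
      simp only [K]
      ring
  obtain ⟨c, hc, hray⟩ := IsJthEigenpair.exists_rayleigh (a := T.aBilin hα' hβ') (b := T.bBilin)
    (fun x y => T.aForm_comm x y)
    (fun x hx => T.aForm_self_pos hα₀ hβ₀ hα' hβ' (hac hαlow) (hac hβlow) hx)
    (fun x y => T.bForm_comm x y) hj hpair G
    (fun c hc => by
      obtain ⟨r, hr, hrb, -⟩ := hbounds c hc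
      exact lt_of_lt_of_le (by positivity) hrb)
  obtain ⟨r, hr, hrb, hra⟩ := hbounds c hc
  simp only [Mesh.aBilin_apply, Mesh.bBilin_apply] at hray
  by_cases hl : lamh ≤ 0
  · exact hl.trans (by positivity)
  have h7 : lamh * (r * m / 4) ≤ K * r :=
    (mul_le_mul_of_nonneg_left hrb (not_le.1 hl).le).trans (hray.trans hra)
  rw [le_div_iff₀ hm]
  have h8 : lamh * m * r ≤ 4 * K * r := by linarith
  exact le_of_mul_le_mul_right h8 hr

theorem exists_ae_le_of_memLp_top {X : Type*} [MeasurableSpace X] {μ : Measure X} {f : X → ℝ}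
    (hf : MemLp f ∞ μ) : ∃ B : ℝ, 0 ≤ B ∧ ∀ᵐ x ∂μ, f x ≤ B := by
  refine ⟨(eLpNormEssSup f μ).toReal, ENNReal.toReal_nonneg, ?_⟩
  have hfin : eLpNormEssSup f μ ≠ (⊤ : ℝ≥0∞) := by
    have := hf.2
    rw [eLpNorm_exponent_top] at this
    exact this.ne
  filter_upwards [ae_le_eLpNormEssSup (f := f) (μ := μ)] with x hx
  have := ENNReal.toReal_mono hfin hx
  exact (le_abs_self _).trans (by simpa using this)

/-! ### The corrected eigenvalue -/

namespace Mesh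

variable {Ω : Set (E d)} (T : Mesh Ω) {α β : E d → ℝ} {α₀ β₀ δ : ℝ}

theorem corrM_nonneg (hα₀ : 0 < α₀) (hδ : 0 < δ) (c : T.cells → ℝ) (u : T.crSpace) :
    0 ≤ T.corrM α β α₀ δ c u :=
  mul_nonneg (by positivity) (T.correctionSum_nonneg c u)

/-- The denominator of the corrected eigenvalue is `(lamh + M) / lamh`, with `M` the value of
`corrM`. -/
theorem sub_correctedEigenvalue (hα₀ : 0 < α₀) (hδ : 0 < δ) (c : T.cells → ℝ) (u : T.crSpace)
    (lam : ℝ) {lamh : ℝ} (hlamh : 0 < lamh) :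
    lam - T.correctedEigenvalue α β α₀ δ c lamh u = (lam - lamh) +
      lamh * T.corrM α β α₀ δ c u / (lamh + T.corrM α β α₀ δ c u) := by
  have hS := T.correctionSum_nonneg (α := α) (β := β) c u
  unfold correctedEigenvalue corrM
  set S := T.correctionSum α β c u
  have h1 : lamh + δ / α₀ * S ≠ 0 := by positivity
  have h2 : 1 + δ / (lamh * α₀) * S = (lamh + δ / α₀ * S) / lamh := by field_simp
  rw [h2]
  field_simp
  ring

/-- Discrete eigenvalues are positive. -/
theorem pos_of_isEigenpair (hα₀ : 0 < α₀) (hβ₀ : 0 < β₀)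
    (hα : ∀ κ : T.cells, MemLp α ∞ (volume.restrict (T.body κ)))
    (hβ : ∀ κ : T.cells, MemLp β ∞ (volume.restrict (T.body κ)))
    (hαlow : ∀ κ : T.cells, ∀ᵐ x ∂(volume.restrict (T.body κ)), α₀ ≤ α x)
    (hβlow : ∀ κ : T.cells, ∀ᵐ x ∂(volume.restrict (T.body κ)), β₀ ≤ β x) {lamh : ℝ}
    {u : T.crSpace} (h : IsEigenpair (T.aForm α β) T.bForm lamh u) : 0 < lamh := by
  have hu : u ≠ 0 := by
    rintro rfl
    have := h.1
    simp [bForm] at this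
  have h1 := h.2 u
  rw [h.1, mul_one] at h1
  rw [← h1]
  exact T.aForm_self_pos hα₀ hβ₀ hα hβ hαlow hβlow hu

/-- An a.e. Lipschitz coefficient is approximated to first order by its interpolant. -/
theorem IsPiecewiseConstInterp.ae_abs_sub_le_meshSize {T : Mesh Ω} {c : T.cells → ℝ}
    (hc : T.IsPiecewiseConstInterp α c) (hΩ : interior (closure Ω) = Ω) {L : ℝ} (hL0 : 0 ≤ L)
    (hL : ∀ U : Set (E d), IsOpen U → Convex ℝ U → U ⊆ Ω →
      ∀ᵐ x ∂(volume.restrict U), ∀ᵐ y ∂(volume.restrict U), |α x - α y| ≤ L * dist x y)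
    (κ : T.cells) : ∀ᵐ x ∂(volume.restrict (T.body κ)), |α x - c κ| ≤ L * T.meshSize := by
  refine hc.ae_abs_sub_le ?_
  have h := hL _ isOpen_interior (T.convex_body κ).interior (T.interior_body_subset hΩ κ)
  rw [T.restrict_interior_body] at h
  have hmem := ae_restrict_mem (μ := volume) (T.measurableSet_body κ)
  filter_upwards [h, hmem] with x hx hxκ
  filter_upwards [hx, hmem] with y hy hyκ
  exact hy.trans (mul_le_mul_of_nonneg_left
    ((T.dist_le_cellDiam κ hxκ hyκ).trans (T.cellDiam_le_meshSize κ)) hL0)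

end Mesh

/-! ### Convergence orders under perturbation -/

/-- A perturbation of size `O(h ^ 2)` does not affect convergence orders up to `2`. -/
theorem isBigO_iff_and_isTheta_iff_of_add {e e' q h : ℕ → ℝ} (h0 : ∀ n, 0 ≤ h n)
    (hh : Tendsto h atTop (𝓝 0)) (hq : q =O[atTop] fun n => h n ^ 2)
    (he : ∀ n, e' n = e n + q n) :
    (∀ s : ℝ, 0 < s → s ≤ 2 →
      (e =O[atTop] (fun n => h n ^ s) ↔ e' =O[atTop] fun n => h n ^ s)) ∧
    ∀ s : ℝ, 0 < s → s < 2 →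
      (e =Θ[atTop] (fun n => h n ^ s) ↔ e' =Θ[atTop] fun n => h n ^ s) := by
  have hsplit : ∀ s : ℝ, 0 < s → ∀ n, h n ^ 2 = h n ^ (2 - s) * h n ^ s := by
    intro s hs n
    rcases (h0 n).eq_or_lt with hz | hp
    · simp [← hz, Real.zero_rpow hs.ne']
    · rw [← Real.rpow_add hp, sub_add_cancel, Real.rpow_two]
  have he1 : e' = e + q := funext he
  have he2 : e = e' - q := by simp [he1]
  constructor
  · intro s hs hs2
    have hqs : q =O[atTop] fun n => h n ^ s := by
      refine hq.trans (IsBigO.of_bound 1 ?_)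
      filter_upwards [hh.eventually (gt_mem_nhds zero_lt_one)] with n hn
      rw [hsplit s hs n, norm_mul]
      refine mul_le_mul_of_nonneg_right ?_ (norm_nonneg _)
      rw [Real.norm_of_nonneg (Real.rpow_nonneg (h0 n) _)]
      exact Real.rpow_le_one (h0 n) hn.le (by linarith)
    exact ⟨fun H => he1 ▸ H.add hqs, fun H => he2 ▸ H.sub hqs⟩
  · intro s hs hs2
    -- For `s < 2` the factor `h ^ (2 - s)` tends to zero. At `s = 2` the perturbation could cancel
    -- the leading term, so `Θ` need not survive.
    have hqs : q =o[atTop] fun n => h n ^ s := by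
      refine hq.trans_isLittleO ?_
      have hlim : Tendsto (fun n => h n ^ (2 - s)) atTop (𝓝 0) := by
        have := hh.rpow_const (p := 2 - s) (Or.inr (by linarith))
        rwa [Real.zero_rpow (by linarith)] at this
      have := ((isLittleO_one_iff ℝ).2 hlim).mul_isBigO (isBigO_refl (fun n => h n ^ s) atTop)
      simpa only [hsplit s hs, one_mul] using this
    constructor
    · intro H
      rw [he1]
      exact (IsEquivalent.isTheta (u := e + q) (v := e)
        (by simpa [IsEquivalent] using hqs.trans_isTheta H.symm)).trans H
    · intro H
      rw [he2]
      exact (IsEquivalent.isTheta (u := e' - q) (v := e')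
        (by
          rw [IsEquivalent, sub_sub_cancel_left]
          exact (hqs.trans_isTheta H.symm).neg_left)).trans H

end Steklov

end

/-! ### The main theorem -/

theorem theorem3p2 {d : ℕ} (hd : d = 2 ∨ d = 3)
    (Ω : Set (Steklov.E d)) (hΩ : Steklov.IsPolyhedralDomain Ω)
    (α β : Steklov.E d → ℝ) (α₀ β₀ δ : ℝ)
    (hα : Steklov.MemW1Inf Ω α) (hα₀ : 0 < α₀) (hαlow : ∀ᵐ x ∂(volume.restrict Ω), α₀ ≤ α x)
    (hβ : MemLp β ∞ (volume.restrict Ω)) (hβ₀ : 0 < β₀)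
    (hβlow : ∀ᵐ x ∂(volume.restrict Ω), β₀ ≤ β x)
    (hδ : 1 < δ) :
    -- the identity and the bound for arbitrary eigenpairs, with one constant for all meshes
    (∃ C : ℝ, 0 < C ∧
      ∀ (T : Steklov.Mesh Ω) (c : T.cells → ℝ), T.IsPiecewiseConstInterp α c →
      ∀ (lam : ℝ) (u : Steklov.H1 Ω),
        Steklov.IsEigenpair (Steklov.aForm Ω α β) (Steklov.bForm Ω) lam u →
      ∀ (lamh : ℝ) (uh : T.crSpace),
        Steklov.IsEigenpair (T.aForm α β) T.bForm lamh uh →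
        lam - T.correctedEigenvalue α β α₀ δ c lamh uh =
            (lam - lamh) + lamh * T.corrM α β α₀ δ c uh / (lamh + T.corrM α β α₀ δ c uh) ∧
          |T.corrM α β α₀ δ c uh| ≤ C * lamh * T.meshSize ^ 2) ∧
    -- the bound for the `j`-th discrete eigenpairs, free of the discrete eigenvalue
    (∀ σ : ℝ, 0 < σ → ∀ j : ℕ, 1 ≤ j →
      ∃ C h₀ : ℝ, 0 < C ∧ 0 < h₀ ∧
        ∀ (T : Steklov.Mesh Ω), T.ShapeRegular σ → T.meshSize ≤ h₀ →
        ∀ (c : T.cells → ℝ), T.IsPiecewiseConstInterp α c →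
        ∀ (lamh : ℝ) (uh : T.crSpace),
          Steklov.IsJthEigenpair (T.aForm α β) T.bForm j lamh uh →
          |T.corrM α β α₀ δ c uh| ≤ C * T.meshSize ^ 2) ∧
    -- the corrected and the uncorrected `j`-th eigenvalues have the same convergence order
    (∀ σ : ℝ, 0 < σ → ∀ j : ℕ, 1 ≤ j →
      ∀ (lam : ℝ) (u : Steklov.H1 Ω),
        Steklov.IsJthEigenpair (Steklov.aForm Ω α β) (Steklov.bForm Ω) j lam u →
      ∀ (T : ℕ → Steklov.Mesh Ω), (∀ n, (T n).ShapeRegular σ) →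
        Tendsto (fun n => (T n).meshSize) atTop (𝓝 0) →
      ∀ (c : ∀ n, (T n).cells → ℝ), (∀ n, (T n).IsPiecewiseConstInterp α (c n)) →
      ∀ (lamh : ℕ → ℝ) (uh : ∀ n, (T n).crSpace),
        (∀ n, Steklov.IsJthEigenpair ((T n).aForm α β) (T n).bForm j (lamh n) (uh n)) →
        (∀ s : ℝ, 0 < s → s ≤ 2 →
          ((fun n => lam - lamh n) =O[atTop] (fun n => (T n).meshSize ^ s) ↔
            (fun n => lam - (T n).correctedEigenvalue α β α₀ δ (c n) (lamh n) (uh n))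
              =O[atTop] (fun n => (T n).meshSize ^ s))) ∧
        (∀ s : ℝ, 0 < s → s < 2 →
          ((fun n => lam - lamh n) =Θ[atTop] (fun n => (T n).meshSize ^ s) ↔
            (fun n => lam - (T n).correctedEigenvalue α β α₀ δ (c n) (lamh n) (uh n))
              =Θ[atTop] (fun n => (T n).meshSize ^ s)))) := by

  have hd2 : 2 ≤ d := by omega
  have hδ0 : 0 < δ := zero_lt_one.trans hδ
  have hint := hΩ.interior_closure
  obtain ⟨L, hL0, hL⟩ := hα.exists_ae_lipschitz hΩ.isOpen
  obtain ⟨A, hA0, hA⟩ := Steklov.exists_ae_le_of_memLp_top hα.1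
  obtain ⟨B, hB0, hB⟩ := Steklov.exists_ae_le_of_memLp_top hβ
  -- The `+ 1` makes the constant positive without needing `L` or `B` to be positive.
  let C₁ : ℝ := δ / α₀ * (2 * (L ^ 2 / α₀ + B)) + 1
  have hC₁ : 0 < C₁ := by positivity
  have hac : ∀ (T : Steklov.Mesh Ω) {p : Steklov.E d → Prop}, (∀ᵐ x ∂(volume.restrict Ω), p x) →
      ∀ κ : T.cells, ∀ᵐ x ∂(volume.restrict (T.body κ)), p x :=
    fun T _ hp κ => ae_mono (T.restrict_body_le hint κ) hp
  have hα' := fun (T : Steklov.Mesh Ω) κ => hα.1.mono_measure (T.restrict_body_le hint κ)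
  have hβ' := fun (T : Steklov.Mesh Ω) κ => hβ.mono_measure (T.restrict_body_le hint κ)
  have hpos : ∀ (T : Steklov.Mesh Ω) (lamh : ℝ) (uh : T.crSpace),
      Steklov.IsEigenpair (T.aForm α β) T.bForm lamh uh → 0 < lamh := fun T lamh uh h =>
    T.pos_of_isEigenpair hα₀ hβ₀ (hα' T) (hβ' T) (hac T hαlow) (hac T hβlow) h
  have hM : ∀ (T : Steklov.Mesh Ω) (c : T.cells → ℝ), T.IsPiecewiseConstInterp α c →
      ∀ (lamh : ℝ) (uh : T.crSpace), Steklov.IsEigenpair (T.aForm α β) T.bForm lamh uh →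
      |T.corrM α β α₀ δ c uh| ≤ C₁ * lamh * T.meshSize ^ 2 := by
    intro T c hc lamh uh h
    have hlam := hpos T lamh uh h
    have h1 := T.correctionSum_le hα₀ hβ₀ (hα' T) (hβ' T) (hac T hαlow) (hac T hβlow) (hac T hB)
      hB0 (hc.ae_abs_sub_le_meshSize hint hL0 hL) uh
    rw [h.2 uh, h.1, mul_one] at h1
    rw [abs_of_nonneg (T.corrM_nonneg hα₀ hδ0 c uh)]
    calc T.corrM α β α₀ δ c uh
        ≤ δ / α₀ * (2 * (L ^ 2 / α₀ + B) * T.meshSize ^ 2 * lamh) :=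
          mul_le_mul_of_nonneg_left h1 (by positivity)
      _ ≤ δ / α₀ * (2 * (L ^ 2 / α₀ + B) * T.meshSize ^ 2 * lamh) + lamh * T.meshSize ^ 2 :=
          le_add_of_nonneg_right (by positivity)
      _ = C₁ * lamh * T.meshSize ^ 2 := by simp only [C₁]; ring
  have hMj : ∀ σ : ℝ, 0 < σ → ∀ j : ℕ, 1 ≤ j →
      ∃ C h₀ : ℝ, 0 < C ∧ 0 < h₀ ∧
        ∀ (T : Steklov.Mesh Ω), T.ShapeRegular σ → T.meshSize ≤ h₀ →
        ∀ (c : T.cells → ℝ), T.IsPiecewiseConstInterp α c →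
        ∀ (lamh : ℝ) (uh : T.crSpace),
          Steklov.IsJthEigenpair (T.aForm α β) T.bForm j lamh uh →
          |T.corrM α β α₀ δ c uh| ≤ C * T.meshSize ^ 2 := by
    intro σ hσ j hj
    -- Finiteness of the surface measure is read off from some mesh; if there is none, the claim is
    -- vacuous.
    by_cases hne : Nonempty (Steklov.Mesh Ω)
    · obtain ⟨T₀⟩ := hne
      have := T₀.isFiniteMeasure_surfaceMeasure (by omega) hΩ.isOpen hint
      obtain ⟨Λ, h₀, hh₀, hΛ⟩ := Steklov.exists_bound_jth_eigenvalue hd2 hΩ.isOpen hΩ.isBounded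
        hΩ.isConnected.nonempty hint hα.1 hα₀ hαlow hβ hβ₀ hβlow hA hA0 hB hB0 hσ hj
      refine ⟨C₁ * (|Λ| + 1), h₀, by positivity, hh₀, fun T hT hh c hc lamh uh h => ?_⟩
      refine (hM T c hc lamh uh h.1).trans ?_
      have h1 : lamh ≤ |Λ| + 1 := by linarith [hΛ T hT hh lamh uh h, le_abs_self Λ]
      gcongr
    · exact ⟨1, 1, one_pos, one_pos, fun T => absurd ⟨T⟩ hne⟩
  refine ⟨⟨C₁, hC₁, fun T c hc lam u _ lamh uh h =>
    ⟨T.sub_correctedEigenvalue hα₀ hδ0 c uh lam (hpos T lamh uh h), hM T c hc lamh uh h⟩⟩, hMj, ?_⟩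
  intro σ hσ j hj lam u _ T hT hh c hc lamh uh h
  obtain ⟨C, h₀, hC, hh₀, hbound⟩ := hMj σ hσ j hj
  have hlam := fun n => hpos (T n) (lamh n) (uh n) (h n).1
  refine Steklov.isBigO_iff_and_isTheta_iff_of_add
    (q := fun n => lamh n * (T n).corrM α β α₀ δ (c n) (uh n) /
      (lamh n + (T n).corrM α β α₀ δ (c n) (uh n)))
    (fun n => (T n).meshSize_nonneg) hh ?_
    (fun n => (T n).sub_correctedEigenvalue hα₀ hδ0 (c n) (uh n) lam (hlam n))
  refine IsBigO.of_bound C ?_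
  filter_upwards [hh.eventually (gt_mem_nhds hh₀)] with n hn
  have hM0 := (T n).corrM_nonneg (α := α) (β := β) hα₀ hδ0 (c n) (uh n)
  have h1 := hbound (T n) (hT n) hn.le (c n) (hc n) (lamh n) (uh n) (h n)
  rw [abs_of_nonneg hM0] at h1
  have hl := hlam n
  rw [Real.norm_of_nonneg (by positivity), Real.norm_of_nonneg (by positivity)]
  -- The perturbation is at most `M`, since `lamh / (lamh + M) ≤ 1`.
  refine le_trans ?_ h1
  rw [div_le_iff₀ (by positivity)]
  nlinarith [mul_nonneg hM0 hM0]
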